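/- Let $k$ be a field and let $N\hookrightarrow M$ be an extension of unital (associative) $k$-algebras with an $N$-bimodule map $E:M\to N$ and finite dual bases $\{x_i\},\{y_i\}\subset M$, i.e. $\sum_i E(mx_i)y_i=m=\sum_i x_iE(y_im)$ for all $m\in M$, such that $E(1)=1$ and $\sum_i x_iy_i=\lambda^{-1}1$ for some nonzero $\lambda\in k$. Let $M_1=\mathrm{End}(M_N)\cong M\otimes_N M$ be the basic construction: $M\subset M_1$ by left multiplications, $e_1=E\in M_1$ is the first Jones idempotent, $M_1=Me_1M$, and $E_M:M_1\to M$, $E_M(me_1m')=\lambda mm'$. Repeating the construction for $M\subset M_1$ (with the dual bases $\lambda^{-1}x_ie_1$, $e_1y_i$ and the same $\lambda$) gives $M_2=M_1e_2M_1$ and $E_{M_1}:M_2\to M_1$. Put $$U=C_M(N),\quad V=C_{M_1}(M),\quad A=C_{M_1}(N),\quad B=C_{M_2}(M)$$ (centralizers). Assume: 1. (Markov) there is a linear $T:N\to k$ with $T(1)=1$, $T(nn')=T(n'n)$ for $n,n'\in N$, such that $T_0:=T\circ E$ satisfies $T_0(mm')=T_0(m'm)$ for $m,m'\in M$; write $T_1=T_0\circ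 E_M$ and $T_2=T_1\circ E_{M_1}$; 2. (symmetric) $E(um)=E(mu)$ for all $u\in U$, $m\in M$; 3. (symmetric product) $\sum_i y_ix_i=\lambda^{-1}1$, or, alternatively, $T_1(\sum_i x_iue_1y_i)=T_0(u)$ for all $u\in U$; 4. (weak irreducibility) $U$ is Kanzaki separable, i.e. has a symmetric separability element, and $T_0|_U$ is non-degenerate; 5. (depth 2) $E_M$ has finite dual bases consisting of elements of $A$, and $E_{M_1}$ has finite dual bases consisting of elements of $B$. Then $V$ has a unique symmetric separability element $f=\sum f^{(1)}\otimes f^{(2)}\in V\otimes_k V$ (that is, $\sum f^{(1)}f^{(2)}=1$, $\sum vf^{(1)}\otimes f^{(2)}=\sum f^{(1)}\otimes f^{(2)}v$ for all $v\in V$, and $f$ is invariant under the flip), the element $\sum f^{(1)}T_1(f^{(2)})$ of $V$ is invertible, with inverse $w$ say, and the bilinear forms on $A\times B$ $$\langle a,b\rangle=\lambda^{-2}T_2(a\,e_2e_1w\,b),\qquad \langle a,b\rangle'=\lambda^{-2}T_2(b\,e_1e_2w\,a)$$ are non-degenerate. $B$ is finite dimensional and, with its multiplication, it is a weak Hopf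 algebra whose comultiplication, counit and antipode are given by $$\langle a,b_{(1)}\rangle\langle a',b_{(2)}\rangle=\langle aa',b\rangle,\qquad \varepsilon(b)=\langle 1,b\rangle,\qquad \langle a,b\rangle=\langle a,S(b)\rangle'.$$ The algebra $A$, with the dual comultiplication, counit and antipode $$\langle a_{(1)},b\rangle\langle a_{(2)},b'\rangle=\langle a,bb'\rangle,\qquad \varepsilon(a)=\langle a,1\rangle,\qquad \langle S_A(a),b\rangle=\langle a,S(b)\rangle,$$ is a semisimple weak Hopf algebra, and $a\mapsto\langle a,\cdot\rangle$ is an isomorphism of weak Hopf algebras from $A$ onto the dual weak Hopf algebra $B^*$. Here a weak Hopf algebra is an algebra and coalgebra $H$ over $k$ with $\Delta(hg)=\Delta(h)\Delta(g)$, $\varepsilon(hgf)=\varepsilon(hg_{(1)})\varepsilon(g_{(2)}f)=\varepsilon(hg_{(2)})\varepsilon(g_{(1)}f)$, $(\Delta\otimes\mathrm{id})\Delta(1)=(\Delta(1)\otimes1)(1\otimes\Delta(1))=(1\otimes\Delta(1))(\Delta(1)\otimes1)$, and a linear map $S:H\to H$ with $h_{(1)}S(h_{(2)})=(\varepsilon\otimes\mathrm{id})(\Delta(1)(h\otimes1))$,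 $S(h_{(1)})h_{(2)}=(\mathrm{id}\otimes\varepsilon)((1\otimes h)\Delta(1))$ and $S(h_{(1)})h_{(2)}S(h_{(3)})=S(h)$. For finite-dimensional $H$, the dual $H^*$ is the weak Hopf algebra with $\langle\phi\psi,h\rangle=\langle\phi\otimes\psi,\Delta(h)\rangle$, $1_{H^*}=\varepsilon$, $\langle\Delta(\phi),h\otimes g\rangle=\langle\phi,hg\rangle$, $\varepsilon(\phi)=\langle\phi,1\rangle$, $\langle S(\phi),h\rangle=\langle\phi,S(h)\rangle$. -/

import Mathlib

open scoped TensorProduct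

/-! ## Weak Hopf algebras -/

section WeakHopf

open Coalgebra LinearMap

/-- A weak Hopf algebra over a field `k`: an algebra and a coalgebra `H` with a multiplicative
(not necessarily unital) comultiplication, weakened unit and counit axioms, and an antipode. -/
class WeakHopfAlgebra (k H : Type*) [Field k] [Ring H] [Algebra k H] extends Coalgebra k H where
  /-- `Δ(hg) = Δ(h)Δ(g)`. -/
  comul_mul : ∀ h g : H, comul (h * g) = comul h * comul g
  /-- `ε(hgf) = ε(h g₁) ε(g₂ f)`. -/
  counit_mul_mul : ∀ h g f : H, counit (h * g * f) =
    mul' k k (TensorProduct.map (counit ∘ₗ mulLeft k h) (counit ∘ₗ mulRight k f) (comul g))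
  /-- `ε(hgf) = ε(h g₂) ε(g₁ f)`. -/
  counit_mul_mul_swap : ∀ h g f : H, counit (h * g * f) =
    mul' k k (TensorProduct.map (counit ∘ₗ mulLeft k h) (counit ∘ₗ mulRight k f)
      (TensorProduct.comm k H H (comul g)))
  /-- `(Δ ⊗ id)Δ(1) = (Δ(1) ⊗ 1)(1 ⊗ Δ(1))`. -/
  comul_comul_one : comul.rTensor H (comul (1 : H)) =
    (comul (1 : H) ⊗ₜ[k] (1 : H)) *
      (TensorProduct.assoc k H H H).symm ((1 : H) ⊗ₜ[k] comul (1 : H))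
  /-- `(Δ ⊗ id)Δ(1) = (1 ⊗ Δ(1))(Δ(1) ⊗ 1)`. -/
  comul_comul_one_swap : comul.rTensor H (comul (1 : H)) =
    (TensorProduct.assoc k H H H).symm ((1 : H) ⊗ₜ[k] comul (1 : H)) *
      (comul (1 : H) ⊗ₜ[k] (1 : H))
  /-- The antipode `S`. -/
  antipode : H →ₗ[k] H
  /-- `h₁ S(h₂) = (ε ⊗ id)(Δ(1)(h ⊗ 1))`. -/
  mul_antipode : ∀ h : H, mul' k H (antipode.lTensor H (comul h)) =
    TensorProduct.lid k H (counit.rTensor H (comul (1 : H) * (h ⊗ₜ[k] (1 : H))))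
  /-- `S(h₁) h₂ = (id ⊗ ε)((1 ⊗ h)Δ(1))`. -/
  antipode_mul : ∀ h : H, mul' k H (antipode.rTensor H (comul h)) =
    TensorProduct.rid k H (counit.lTensor H (((1 : H) ⊗ₜ[k] h) * comul (1 : H)))
  /-- `S(h₁) h₂ S(h₃) = S(h)`. -/
  antipode_mul_antipode : ∀ h : H,
    mul' k H (TensorProduct.map (mul' k H ∘ₗ antipode.rTensor H) antipode
      (comul.rTensor H (comul h))) = antipode h

/-- An isomorphism of weak Hopf algebras: a bijection which is an algebra and a coalgebra
morphism and commutes with the antipodes. -/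
structure WeakHopfEquiv (k H K : Type*) [Field k] [Ring H] [Algebra k H] [WeakHopfAlgebra k H]
    [Ring K] [Algebra k K] [WeakHopfAlgebra k K] extends H ≃ₐ[k] K where
  map_comul : ∀ h : H, comul (R := k) (toAlgEquiv h) =
    TensorProduct.map toAlgEquiv.toLinearMap toAlgEquiv.toLinearMap (comul (R := k) h)
  map_counit : ∀ h : H, counit (R := k) (toAlgEquiv h) = counit (R := k) h
  map_antipode : ∀ h : H, WeakHopfAlgebra.antipode (k := k) (toAlgEquiv h) =
    toAlgEquiv (WeakHopfAlgebra.antipode (k := k) h)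

/-- The dual space `H* = Hom(H, k)` of a weak Hopf algebra `H`. -/
def WeakHopfDual (k H : Type*) [Field k] [Ring H] [Algebra k H] [WeakHopfAlgebra k H] : Type _ :=
  WithConv (H →ₗ[k] k)

namespace WeakHopfDual

variable {k H : Type*} [Field k] [Ring H] [Algebra k H] [WeakHopfAlgebra k H]

/-- The convolution product `⟨φψ, h⟩ = ⟨φ ⊗ ψ, Δ(h)⟩` on `H*`, with unit `ε`. -/
noncomputable instance instRing : Ring (WeakHopfDual k H) :=
  inferInstanceAs (Ring (WithConv (H →ₗ[k] k)))

noncomputable instance instAlgebra : Algebra k (WeakHopfDual k H) :=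
  inferInstanceAs (Algebra k (WithConv (H →ₗ[k] k)))

/-- An element of `H*` as a linear functional on `H`. -/
noncomputable def toDual : WeakHopfDual k H ≃ₗ[k] Module.Dual k H where
  toFun φ := WithConv.ofConv φ
  invFun φ := WithConv.toConv φ
  map_add' _ _ := rfl
  map_smul' _ _ := rfl
  left_inv _ := rfl
  right_inv _ := rfl

theorem toDual_one_apply (h : H) : toDual (1 : WeakHopfDual k H) h = counit (R := k) h := rfl

theorem toDual_mul_apply (φ ψ : WeakHopfDual k H) (h : H) :
    toDual (φ * ψ) h = mul' k k (TensorProduct.map (toDual φ) (toDual ψ) (comul (R := k) h)) :=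
  rfl

@[ext] theorem ext {φ ψ : WeakHopfDual k H} (h : ∀ a, toDual φ a = toDual ψ a) : φ = ψ :=
  toDual.injective (LinearMap.ext h)

section Contraction

/-- `s₁ ⊗ s₂ ↦ ⟨φ, s₁⟩ s₂`. -/
noncomputable def contrLeft (φ : WeakHopfDual k H) : H ⊗[k] H →ₗ[k] H :=
  (TensorProduct.lid k H).toLinearMap ∘ₗ (toDual φ).rTensor H

/-- `s₁ ⊗ s₂ ↦ s₁ ⟨φ, s₂⟩`. -/
noncomputable def contrRight (φ : WeakHopfDual k H) : H ⊗[k] H →ₗ[k] H :=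
  (TensorProduct.rid k H).toLinearMap ∘ₗ (toDual φ).lTensor H

theorem map_eq_contrLeft (φ ψ : WeakHopfDual k H) (s : H ⊗[k] H) :
    mul' k k (TensorProduct.map (toDual φ) (toDual ψ) s) = toDual ψ (contrLeft φ s) := by
  induction s with
  | zero => simp
  | add x y hx hy => simp only [map_add, hx, hy]
  | tmul a b => simp [contrLeft]

theorem map_eq_contrRight (φ ψ : WeakHopfDual k H) (s : H ⊗[k] H) :
    mul' k k (TensorProduct.map (toDual φ) (toDual ψ) s) = toDual φ (contrRight ψ s) := by
  induction s with
  | zero => simp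
  | add x y hx hy => simp only [map_add, hx, hy]
  | tmul a b => simp [contrRight, mul_comm]

theorem contr_mul (φ ψ χ : WeakHopfDual k H) (s t : H ⊗[k] H) :
    mul' k k (TensorProduct.map (mul' k k ∘ₗ TensorProduct.map (toDual φ) (toDual ψ)) (toDual χ)
      ((s ⊗ₜ[k] (1 : H)) * (TensorProduct.assoc k H H H).symm ((1 : H) ⊗ₜ[k] t))) =
      toDual ψ (contrLeft φ s * contrRight χ t) := by
  induction s with
  | zero => simp
  | add x y hx hy => simp only [map_add, TensorProduct.add_tmul, add_mul, hx, hy]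
  | tmul a b =>
    induction t with
    | zero => simp
    | add x y hx hy => simp only [map_add, TensorProduct.tmul_add, mul_add, hx, hy]
    | tmul c d => simp [contrLeft, contrRight]; ring

theorem contr_mul_swap (φ ψ χ : WeakHopfDual k H) (s t : H ⊗[k] H) :
    mul' k k (TensorProduct.map (mul' k k ∘ₗ TensorProduct.map (toDual φ) (toDual ψ)) (toDual χ)
      ((TensorProduct.assoc k H H H).symm ((1 : H) ⊗ₜ[k] t) * (s ⊗ₜ[k] (1 : H)))) =
      toDual ψ (contrRight χ t * contrLeft φ s) := by
  induction s with
  | zero => simp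
  | add x y hx hy => simp only [map_add, TensorProduct.add_tmul, mul_add, hx, hy]
  | tmul a b =>
    induction t with
    | zero => simp
    | add x y hx hy => simp only [map_add, TensorProduct.tmul_add, add_mul, hx, hy]
    | tmul c d => simp [contrLeft, contrRight]; ring

theorem mul_mul_one_eq (φ ψ χ : WeakHopfDual k H) :
    toDual (φ * ψ * χ) (1 : H) =
      mul' k k (TensorProduct.map (mul' k k ∘ₗ TensorProduct.map (toDual φ) (toDual ψ)) (toDual χ)
        (comul.rTensor H (comul (R := k) (1 : H)))) := by
  rw [toDual_mul_apply]
  induction comul (R := k) (1 : H) with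
  | zero => simp
  | add x y hx hy => simp only [map_add, hx, hy]
  | tmul a b => simp [toDual_mul_apply]

/-- The antipode of the dual, `⟨S(φ), h⟩ = ⟨φ, S(h)⟩`. -/
noncomputable def antipode : WeakHopfDual k H →ₗ[k] WeakHopfDual k H :=
  toDual.symm.toLinearMap ∘ₗ (WeakHopfAlgebra.antipode (k := k) (H := H)).dualMap ∘ₗ
    toDual.toLinearMap

theorem toDual_antipode (φ : WeakHopfDual k H) :
    toDual (antipode φ) = toDual φ ∘ₗ WeakHopfAlgebra.antipode (k := k) := rfl

theorem toDual_target (φ : WeakHopfDual k H) (s : H ⊗[k] H) (h : H) :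
    toDual φ (TensorProduct.lid k H (counit.rTensor H (s * (h ⊗ₜ[k] (1 : H))))) =
      counit (R := k) (contrRight φ s * h) := by
  induction s with
  | zero => simp
  | add x y hx hy => simp only [add_mul, map_add, hx, hy]
  | tmul a b => simp [contrRight, mul_comm]

theorem toDual_source (φ : WeakHopfDual k H) (s : H ⊗[k] H) (h : H) :
    toDual φ (TensorProduct.rid k H (counit.lTensor H (((1 : H) ⊗ₜ[k] h) * s))) =
      counit (R := k) (h * contrLeft φ s) := by
  induction s with
  | zero => simp
  | add x y hx hy => simp only [mul_add, map_add, hx, hy]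
  | tmul a b => simp [contrLeft, mul_comm]

end Contraction

variable [Module.Finite k H]

/-- The identification of `H* ⊗ H*` with `(H ⊗ H)*` through the pairing
`⟨φ ⊗ ψ, h ⊗ g⟩ = ⟨φ, h⟩⟨ψ, g⟩`. -/
noncomputable def ev₂ : WeakHopfDual k H ⊗[k] WeakHopfDual k H ≃ₗ[k] Module.Dual k (H ⊗[k] H) :=
  TensorProduct.congr toDual toDual ≪≫ₗ TensorProduct.dualDistribEquiv k H H

theorem ev₂_tmul (φ ψ : WeakHopfDual k H) (t : H ⊗[k] H) :
    ev₂ (φ ⊗ₜ[k] ψ) t = mul' k k (TensorProduct.map (toDual φ) (toDual ψ) t) := by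
  induction t with
  | zero => simp
  | add x y hx hy => rw [map_add, hx, hy, map_add, map_add]
  | tmul h g =>
    simp [ev₂, TensorProduct.dualDistribEquivOfBasis, TensorProduct.dualDistrib_apply]

/-- The identification of `(H* ⊗ H*) ⊗ H*` with `((H ⊗ H) ⊗ H)*`. -/
noncomputable def ev₃ : (WeakHopfDual k H ⊗[k] WeakHopfDual k H) ⊗[k] WeakHopfDual k H ≃ₗ[k]
    Module.Dual k ((H ⊗[k] H) ⊗[k] H) :=
  TensorProduct.congr ev₂ toDual
    ≪≫ₗ TensorProduct.dualDistribEquiv k (H ⊗[k] H) H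

theorem ev₃_tmul (x : WeakHopfDual k H ⊗[k] WeakHopfDual k H) (ψ : WeakHopfDual k H)
    (t : H ⊗[k] H) (h : H) : ev₃ (x ⊗ₜ[k] ψ) (t ⊗ₜ[k] h) = ev₂ x t * toDual ψ h := by
  simp [ev₃, TensorProduct.dualDistribEquivOfBasis, TensorProduct.dualDistrib_apply]

theorem ev₂_ext {x y : WeakHopfDual k H ⊗[k] WeakHopfDual k H}
    (h : ∀ a b : H, ev₂ x (a ⊗ₜ[k] b) = ev₂ y (a ⊗ₜ[k] b)) : x = y :=
  ev₂.injective (TensorProduct.ext' h)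

theorem ev₃_ext {x y : (WeakHopfDual k H ⊗[k] WeakHopfDual k H) ⊗[k] WeakHopfDual k H}
    (h : ∀ a b c : H, ev₃ x ((a ⊗ₜ[k] b) ⊗ₜ[k] c) = ev₃ y ((a ⊗ₜ[k] b) ⊗ₜ[k] c)) : x = y :=
  ev₃.injective (TensorProduct.ext_threefold h)

/-- The comultiplication of the dual, `⟨Δ(φ), h ⊗ g⟩ = ⟨φ, hg⟩`, and its counit `φ ↦ ⟨φ, 1⟩`. -/
noncomputable instance instCoalgebraStruct : CoalgebraStruct k (WeakHopfDual k H) where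
  comul := ev₂.symm.toLinearMap ∘ₗ (mul' k H).dualMap ∘ₗ
    toDual.toLinearMap
  counit := Module.Dual.eval k H 1 ∘ₗ toDual.toLinearMap

@[simp] theorem ev₂_comul (φ : WeakHopfDual k H) (t : H ⊗[k] H) :
    ev₂ (comul (R := k) φ) t = toDual φ (mul' k H t) := by
  simp [comul]

@[simp] theorem counit_apply (φ : WeakHopfDual k H) : counit (R := k) φ = toDual φ 1 := rfl

theorem ev₃_rTensor_comul (x : WeakHopfDual k H ⊗[k] WeakHopfDual k H) (a b c : H) :
    ev₃ (comul.rTensor _ x) ((a ⊗ₜ[k] b) ⊗ₜ[k] c) = ev₂ x ((a * b) ⊗ₜ[k] c) := by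
  induction x with
  | zero => simp
  | add x y hx hy => simp only [map_add, LinearMap.add_apply, hx, hy]
  | tmul φ ψ => simp [ev₃_tmul, ev₂_tmul]

theorem ev₃_assoc_symm (φ : WeakHopfDual k H) (x : WeakHopfDual k H ⊗[k] WeakHopfDual k H)
    (a b c : H) :
    ev₃ ((TensorProduct.assoc k _ _ _).symm (φ ⊗ₜ[k] x)) ((a ⊗ₜ[k] b) ⊗ₜ[k] c) =
      toDual φ a * ev₂ x (b ⊗ₜ[k] c) := by
  induction x with
  | zero => simp
  | add x y hx hy => simp only [TensorProduct.tmul_add, map_add, LinearMap.add_apply, hx, hy,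
      mul_add]
  | tmul φ ψ => simp [ev₃_tmul, ev₂_tmul, mul_assoc]

theorem ev₃_lTensor_comul (x : WeakHopfDual k H ⊗[k] WeakHopfDual k H) (a b c : H) :
    ev₃ ((TensorProduct.assoc k _ _ _).symm (comul.lTensor _ x)) ((a ⊗ₜ[k] b) ⊗ₜ[k] c) =
      ev₂ x (a ⊗ₜ[k] (b * c)) := by
  induction x with
  | zero => simp
  | add x y hx hy => simp only [map_add, LinearMap.add_apply, hx, hy]
  | tmul φ ψ => simp [ev₃_assoc_symm, ev₂_tmul]

theorem rTensor_counit (x : WeakHopfDual k H ⊗[k] WeakHopfDual k H) (h : H) :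
    toDual (TensorProduct.lid k _ (counit.rTensor _ x)) h = ev₂ x (1 ⊗ₜ[k] h) := by
  induction x with
  | zero => simp
  | add x y hx hy => simp only [map_add, LinearMap.add_apply, hx, hy]
  | tmul φ ψ => simp [ev₂_tmul]

theorem lTensor_counit (x : WeakHopfDual k H ⊗[k] WeakHopfDual k H) (h : H) :
    toDual (TensorProduct.rid k _ (counit.lTensor _ x)) h = ev₂ x (h ⊗ₜ[k] 1) := by
  induction x with
  | zero => simp
  | add x y hx hy => simp only [map_add, LinearMap.add_apply, hx, hy]
  | tmul φ ψ => simp [ev₂_tmul, mul_comm]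

noncomputable instance instCoalgebra : Coalgebra k (WeakHopfDual k H) where
  coassoc := by
    ext φ
    apply (TensorProduct.assoc k _ _ _).symm.injective
    refine ev₃_ext fun a b c => ?_
    simp [ev₃_rTensor_comul, ev₃_lTensor_comul, mul_assoc]
  rTensor_counit_comp_comul := by
    ext φ
    apply (TensorProduct.lid k _).injective
    ext h
    simp [rTensor_counit]
  lTensor_counit_comp_comul := by
    ext φ
    apply (TensorProduct.rid k _).injective
    ext h
    simp [lTensor_counit]

theorem ev₂_mul_aux (φ ψ φ' ψ' : WeakHopfDual k H) (s t : H ⊗[k] H) :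
    mul' k k (TensorProduct.map (toDual φ) (toDual φ') s) *
      mul' k k (TensorProduct.map (toDual ψ) (toDual ψ') t) =
      mul' k k (TensorProduct.map (ev₂ (φ ⊗ₜ[k] ψ)) (ev₂ (φ' ⊗ₜ[k] ψ'))
        (TensorProduct.tensorTensorTensorComm k H H H H (s ⊗ₜ[k] t))) := by
  induction s with
  | zero => simp
  | add x y hx hy => simp only [map_add, TensorProduct.add_tmul, add_mul, hx, hy]
  | tmul a b =>
    induction t with
    | zero => simp
    | add x y hx hy => simp only [map_add, TensorProduct.tmul_add, mul_add, hx, hy]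
    | tmul c d => simp [ev₂_tmul]; ring

theorem map_mul_aux (φ ψ : WeakHopfDual k H) (s t : H ⊗[k] H) :
    mul' k k (TensorProduct.map (ev₂ (comul (R := k) φ)) (ev₂ (comul (R := k) ψ))
        (TensorProduct.tensorTensorTensorComm k H H H H (s ⊗ₜ[k] t))) =
      mul' k k (TensorProduct.map (toDual φ) (toDual ψ) (s * t)) := by
  induction s with
  | zero => simp
  | add x y hx hy => simp only [map_add, TensorProduct.add_tmul, add_mul, hx, hy]
  | tmul a b =>
    induction t with
    | zero => simp
    | add x y hx hy => simp only [map_add, TensorProduct.tmul_add, mul_add, hx, hy]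
    | tmul c d => simp

theorem ev₃_comul_apply (φ : WeakHopfDual k H) (u : (H ⊗[k] H) ⊗[k] H) :
    ev₃ (comul.rTensor _ (comul (R := k) φ)) u = toDual φ (mul' k H ((mul' k H).rTensor H u)) := by
  induction u with
  | zero => simp
  | add x y hx hy => simp only [map_add, hx, hy]
  | tmul t c =>
    induction t with
    | zero => simp
    | add x y hx hy => simp only [map_add, TensorProduct.add_tmul, hx, hy]
    | tmul a b => simp [ev₃_rTensor_comul]

theorem ev₂_mul (x y : WeakHopfDual k H ⊗[k] WeakHopfDual k H) (a b : H) :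
    ev₂ (x * y) (a ⊗ₜ[k] b) = mul' k k (TensorProduct.map (ev₂ x) (ev₂ y)
      (TensorProduct.tensorTensorTensorComm k H H H H
        (comul (R := k) a ⊗ₜ[k] comul (R := k) b))) := by
  induction x with
  | zero => simp
  | add x x' hx hy => simp only [map_add, add_mul, LinearMap.add_apply, hx, hy,
      TensorProduct.map_add_left]
  | tmul φ ψ =>
    induction y with
    | zero => simp
    | add x x' hx hy => simp only [map_add, mul_add, LinearMap.add_apply, hx, hy,
        TensorProduct.map_add_right]
    | tmul φ' ψ' =>
      rw [← ev₂_mul_aux]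
      simp [ev₂_tmul, toDual_mul_apply]

theorem ev₃_mul (x y : WeakHopfDual k H ⊗[k] WeakHopfDual k H) (a b c : H) :
    ev₃ ((x ⊗ₜ[k] (1 : WeakHopfDual k H)) *
      (TensorProduct.assoc k _ _ _).symm ((1 : WeakHopfDual k H) ⊗ₜ[k] y))
        ((a ⊗ₜ[k] b) ⊗ₜ[k] c) =
      mul' k k (TensorProduct.map (ev₂ x ∘ₗ TensorProduct.mk k H H a)
        (ev₂ y ∘ₗ (TensorProduct.mk k H H).flip c) (comul (R := k) b)) := by
  induction x with
  | zero => simp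
  | add x x' hx hy => simp only [map_add, TensorProduct.add_tmul, add_mul, LinearMap.add_apply,
      hx, hy, TensorProduct.map_add_left, LinearMap.add_comp]
  | tmul φ ψ =>
    induction y with
    | zero => simp
    | add x x' hx hy => simp only [map_add, TensorProduct.tmul_add, mul_add, LinearMap.add_apply,
        hx, hy, TensorProduct.map_add_right, LinearMap.add_comp]
    | tmul φ' ψ' =>
      simp only [TensorProduct.assoc_symm_tmul, Algebra.TensorProduct.tmul_mul_tmul, mul_one,
        one_mul, ev₃_tmul, ev₂_tmul, TensorProduct.map_tmul, mul'_apply, toDual_mul_apply]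
      induction comul (R := k) b with
      | zero => simp
      | add x y hx hy => simp only [map_add, add_mul, mul_add, hx, hy]
      | tmul d e => simp [ev₂_tmul]; ring

theorem ev₃_mul_swap (x y : WeakHopfDual k H ⊗[k] WeakHopfDual k H) (a b c : H) :
    ev₃ ((TensorProduct.assoc k _ _ _).symm ((1 : WeakHopfDual k H) ⊗ₜ[k] y) *
      (x ⊗ₜ[k] (1 : WeakHopfDual k H))) ((a ⊗ₜ[k] b) ⊗ₜ[k] c) =
      mul' k k (TensorProduct.map (ev₂ x ∘ₗ TensorProduct.mk k H H a)
        (ev₂ y ∘ₗ (TensorProduct.mk k H H).flip c)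
        (TensorProduct.comm k H H (comul (R := k) b))) := by
  induction x with
  | zero => simp
  | add x x' hx hy => simp only [map_add, TensorProduct.add_tmul, mul_add, LinearMap.add_apply,
      hx, hy, TensorProduct.map_add_left, LinearMap.add_comp]
  | tmul φ ψ =>
    induction y with
    | zero => simp
    | add x x' hx hy => simp only [map_add, TensorProduct.tmul_add, add_mul, LinearMap.add_apply,
        hx, hy, TensorProduct.map_add_right, LinearMap.add_comp]
    | tmul φ' ψ' =>
      simp only [TensorProduct.assoc_symm_tmul, Algebra.TensorProduct.tmul_mul_tmul, mul_one,
        one_mul, ev₃_tmul, ev₂_tmul, TensorProduct.map_tmul, mul'_apply, toDual_mul_apply]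
      induction comul (R := k) b with
      | zero => simp
      | add x y hx hy => simp only [map_add, add_mul, mul_add, hx, hy]
      | tmul d e => simp [ev₂_tmul]; ring

theorem counit_map (φ χ : WeakHopfDual k H) (x : WeakHopfDual k H ⊗[k] WeakHopfDual k H) :
    mul' k k (TensorProduct.map (counit ∘ₗ mulLeft k φ) (counit ∘ₗ mulRight k χ) x) =
      ev₂ x (contrLeft φ (comul (R := k) 1) ⊗ₜ[k] contrRight χ (comul (R := k) 1)) := by
  induction x with
  | zero => simp
  | add x y hx hy => simp only [map_add, hx, hy, LinearMap.add_apply]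
  | tmul α β =>
    simp [ev₂_tmul, toDual_mul_apply φ α, toDual_mul_apply β χ, map_eq_contrLeft φ α,
      map_eq_contrRight β χ]

theorem mul'_lTensor_antipode (x : WeakHopfDual k H ⊗[k] WeakHopfDual k H) (h : H) :
    toDual (mul' k _ (antipode.lTensor _ x)) h =
      ev₂ x ((WeakHopfAlgebra.antipode (k := k)).lTensor H (comul (R := k) h)) := by
  induction x with
  | zero => simp
  | add x y hx hy => simp only [map_add, LinearMap.add_apply, hx, hy]
  | tmul φ ψ =>
    rw [lTensor_tmul, mul'_apply, toDual_mul_apply, toDual_antipode, ev₂_tmul, lTensor,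
      TensorProduct.map_map, LinearMap.comp_id]

theorem mul'_rTensor_antipode (x : WeakHopfDual k H ⊗[k] WeakHopfDual k H) (h : H) :
    toDual (mul' k _ (antipode.rTensor _ x)) h =
      ev₂ x ((WeakHopfAlgebra.antipode (k := k)).rTensor H (comul (R := k) h)) := by
  induction x with
  | zero => simp
  | add x y hx hy => simp only [map_add, LinearMap.add_apply, hx, hy]
  | tmul φ ψ =>
    rw [rTensor_tmul, mul'_apply, toDual_mul_apply, toDual_antipode, ev₂_tmul, rTensor,
      TensorProduct.map_map, LinearMap.comp_id]

theorem ev₂_mul_tmul_one (φ : WeakHopfDual k H) (x : WeakHopfDual k H ⊗[k] WeakHopfDual k H)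
    (h : H) : ev₂ (x * (φ ⊗ₜ[k] 1)) (1 ⊗ₜ[k] h) =
      ev₂ x (contrRight φ (comul (R := k) 1) ⊗ₜ[k] h) := by
  induction x with
  | zero => simp
  | add x y hx hy => simp only [add_mul, map_add, LinearMap.add_apply, hx, hy]
  | tmul α β =>
    simp [ev₂_tmul, toDual_mul_apply α φ, map_eq_contrRight _ φ]

theorem ev₂_one_tmul_mul (φ : WeakHopfDual k H) (x : WeakHopfDual k H ⊗[k] WeakHopfDual k H)
    (h : H) : ev₂ ((1 ⊗ₜ[k] φ) * x) (h ⊗ₜ[k] 1) =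
      ev₂ x (h ⊗ₜ[k] contrLeft φ (comul (R := k) 1)) := by
  induction x with
  | zero => simp
  | add x y hx hy => simp only [mul_add, map_add, LinearMap.add_apply, hx, hy]
  | tmul α β =>
    simp [ev₂_tmul, toDual_mul_apply φ β, map_eq_contrLeft φ]

theorem toDual_antipode_mul_antipode
    (y : (WeakHopfDual k H ⊗[k] WeakHopfDual k H) ⊗[k] WeakHopfDual k H) (h : H) :
    toDual (mul' k _ (TensorProduct.map (mul' k _ ∘ₗ antipode.rTensor _) antipode y)) h =
      ev₃ y (TensorProduct.map ((WeakHopfAlgebra.antipode (k := k)).rTensor H)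
        (WeakHopfAlgebra.antipode (k := k)) (comul.rTensor H (comul (R := k) h))) := by
  induction y with
  | zero => simp
  | add x y hx hy => simp only [map_add, LinearMap.add_apply, hx, hy]
  | tmul x φ =>
    simp only [TensorProduct.map_tmul, mul'_apply, toDual_mul_apply]
    induction comul (R := k) h with
    | zero => simp
    | add s t hs ht => simp only [map_add, hs, ht]
    | tmul a b =>
      simp only [TensorProduct.map_tmul, mul'_apply, rTensor_tmul, ev₃_tmul, toDual_antipode,
        LinearMap.comp_apply, mul'_rTensor_antipode]

/-- The dual weak Hopf algebra: all structure maps are dual to those of `H`, in particular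
`⟨S(φ), h⟩ = ⟨φ, S(h)⟩`. -/
noncomputable instance instWeakHopfAlgebra : WeakHopfAlgebra k (WeakHopfDual k H) where
  comul_mul φ ψ := ev₂_ext fun a b => by
    rw [ev₂_mul, map_mul_aux, ← WeakHopfAlgebra.comul_mul]
    simp [toDual_mul_apply]
  counit_mul_mul φ ψ χ := by
    rw [counit_map, counit_apply, mul_mul_one_eq, WeakHopfAlgebra.comul_comul_one, contr_mul]
    simp
  counit_mul_mul_swap φ ψ χ := by
    rw [counit_apply, mul_mul_one_eq, WeakHopfAlgebra.comul_comul_one_swap, contr_mul_swap]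
    have key : ∀ x : WeakHopfDual k H ⊗[k] WeakHopfDual k H,
        mul' k k (TensorProduct.map (counit ∘ₗ mulLeft k φ) (counit ∘ₗ mulRight k χ)
          (TensorProduct.comm k _ _ x)) =
        ev₂ x (contrRight χ (comul (R := k) 1) ⊗ₜ[k] contrLeft φ (comul (R := k) 1)) := by
      intro x
      induction x with
      | zero => simp
      | add x y hx hy => simp only [map_add, hx, hy, LinearMap.add_apply]
      | tmul α β =>
        simp [ev₂_tmul, toDual_mul_apply φ β, toDual_mul_apply α χ, map_eq_contrLeft φ β,
          map_eq_contrRight α χ, mul_comm]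
    rw [key]
    simp
  comul_comul_one := ev₃_ext fun a b c => by
    rw [ev₃_mul, ev₃_rTensor_comul, ev₂_comul, mul'_apply, toDual_one_apply,
      WeakHopfAlgebra.counit_mul_mul]
    congr 2
    congr 1 <;> ext <;> simp [toDual_one_apply]
  comul_comul_one_swap := ev₃_ext fun a b c => by
    rw [ev₃_mul_swap, ev₃_rTensor_comul, ev₂_comul, mul'_apply, toDual_one_apply,
      WeakHopfAlgebra.counit_mul_mul_swap]
    congr 2
    congr 1 <;> ext <;> simp [toDual_one_apply]
  antipode := antipode
  mul_antipode φ := by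
    ext h
    rw [mul'_lTensor_antipode, ev₂_comul, WeakHopfAlgebra.mul_antipode, toDual_target,
      rTensor_counit, ev₂_mul_tmul_one, ev₂_comul, mul'_apply, toDual_one_apply]
  antipode_mul φ := by
    ext h
    rw [mul'_rTensor_antipode, ev₂_comul, WeakHopfAlgebra.antipode_mul, toDual_source,
      lTensor_counit, ev₂_one_tmul_mul, ev₂_comul, mul'_apply, toDual_one_apply]
  antipode_mul_antipode φ := by
    ext h
    rw [toDual_antipode_mul_antipode, ev₃_comul_apply, toDual_antipode, LinearMap.comp_apply,
      ← WeakHopfAlgebra.antipode_mul_antipode, rTensor, TensorProduct.map_map, LinearMap.id_comp]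

end WeakHopfDual

end WeakHopf

/-! ## Frobenius extensions and the basic construction -/

noncomputable section Tower

/-- A strongly separable (Frobenius) extension of `k`-algebras `N ↪ M` with its Frobenius
coordinates: an `N`-bimodule map `E : M → N` with dual bases `xᵢ`, `yᵢ`, such that `E(1) = 1` and
`∑ xᵢ yᵢ = λ⁻¹ 1` with `λ ≠ 0`. (Since `E(1) = 1`, the map `N → M` is injective.) -/
structure StronglySeparableExtension (k N M : Type*) [Field k] [Ring N] [Ring M] [Algebra k N]
    [Algebra k M] where
  /-- The embedding `N ↪ M`. -/
  incl : N →ₐ[k] M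
  /-- The Frobenius homomorphism. -/
  E : M →ₗ[k] N
  E_incl_mul : ∀ n m, E (incl n * m) = n * E m
  E_mul_incl : ∀ m n, E (m * incl n) = E m * n
  /-- The size of the dual bases. -/
  size : ℕ
  /-- The left dual basis. -/
  x : Fin size → M
  /-- The right dual basis. -/
  y : Fin size → M
  sum_E_mul : ∀ m, ∑ i, incl (E (m * x i)) * y i = m
  sum_mul_E : ∀ m, ∑ i, x i * incl (E (y i * m)) = m
  E_one : E 1 = 1
  /-- The reciprocal `λ` of the index. -/
  lam : k
  lam_ne_zero : lam ≠ 0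
  sum_x_mul_y : ∑ i, x i * y i = algebraMap k M lam⁻¹

namespace StronglySeparableExtension

variable {k N M : Type*} [Field k] [Ring N] [Ring M] [Algebra k N] [Algebra k M]
  (D : StronglySeparableExtension k N M)

theorem E_incl (n : N) : D.E (D.incl n) = n := by
  simpa [D.E_one] using D.E_incl_mul n 1

theorem incl_injective : Function.Injective D.incl := fun a b h => by
  rw [← D.E_incl a, h, D.E_incl]

/-- The algebra `End(M_N)` of right `N`-linear endomorphisms of `M`. This is the basic
construction `M₁ = M e₁ M ≅ M ⊗_N M`. -/
def endRight : Subalgebra k (Module.End k M) where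
  carrier := {f | ∀ m n, f (m * D.incl n) = f m * D.incl n}
  mul_mem' {f g} hf hg m n := by
    simp only [Set.mem_ofPred_eq] at hf hg
    simp [Module.End.mul_apply, hf, hg]
  add_mem' {f g} hf hg m n := by
    simp only [Set.mem_ofPred_eq] at hf hg
    simp [hf, hg, add_mul]
  algebraMap_mem' r m n := by simp

/-- The algebra `M₁ = End(M_N)`, as a type. -/
def M₁ : Type _ := D.endRight

instance instRingM₁ : Ring D.M₁ := inferInstanceAs (Ring D.endRight)

instance instAlgebraM₁ : Algebra k D.M₁ := inferInstanceAs (Algebra k D.endRight)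

/-- The inclusion of `M₁ = End(M_N)` in `End_k(M)`. -/
def toEnd : D.M₁ →ₐ[k] Module.End k M := D.endRight.val

theorem toEnd_mul_incl (f : D.M₁) (m : M) (n : N) :
    D.toEnd f (m * D.incl n) = D.toEnd f m * D.incl n := f.2 m n

variable {D} in
theorem M₁_ext {f g : D.M₁} (h : ∀ m, D.toEnd f m = D.toEnd g m) : f = g :=
  Subtype.ext (LinearMap.ext h)

/-- Left multiplications, `M ↪ M₁`. -/
def mulLeftHom : M →ₐ[k] D.M₁ :=
  (Algebra.lmul k M).codRestrict D.endRight fun a m n => by simp [mul_assoc]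

@[simp] theorem mulLeftHom_apply (a m : M) : D.toEnd (D.mulLeftHom a) m = a * m := rfl

/-- The Jones idempotent `e₁ = E ∈ M₁`. -/
def jones : D.M₁ :=
  (⟨D.incl.toLinearMap ∘ₗ D.E, fun m n => by simp [D.E_mul_incl]⟩ : D.endRight)

@[simp] theorem jones_apply (m : M) : D.toEnd D.jones m = D.incl (D.E m) := rfl

/-- The conditional expectation `E_M : M₁ → M`, `E_M(f) = λ ∑ f(xᵢ) yᵢ`. It is the map
`m e₁ m' ↦ λ m m'`, see `condExp_mul_jones_mul`. -/
def condExp : D.M₁ →ₗ[k] M :=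
  D.lam • ∑ i, (LinearMap.mulRight k (D.y i)) ∘ₗ (LinearMap.applyₗ (D.x i)) ∘ₗ
    D.toEnd.toLinearMap

theorem condExp_apply (f : D.M₁) :
    D.condExp f = D.lam • ∑ i, D.toEnd f (D.x i) * D.y i := by
  simp [condExp]

theorem sum_apply_mul_E (f : D.M₁) (m : M) :
    ∑ i, D.toEnd f (D.x i) * D.incl (D.E (D.y i * m)) = D.toEnd f m := by
  conv_rhs => rw [← D.sum_mul_E m, map_sum]
  exact Finset.sum_congr rfl fun i _ => (D.toEnd_mul_incl f _ _).symm

theorem condExp_mul_jones_mul (m m' : M) :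
    D.condExp (D.mulLeftHom m * D.jones * D.mulLeftHom m') = D.lam • (m * m') := by
  rw [condExp_apply]
  congr 1
  conv_rhs => rw [← D.sum_E_mul m', Finset.mul_sum]
  simp [mul_assoc]

theorem condExp_mulLeftHom_mul (m : M) (f : D.M₁) :
    D.condExp (D.mulLeftHom m * f) = m * D.condExp f := by
  simp [condExp_apply, Finset.mul_sum, mul_assoc]

theorem condExp_mul_mulLeftHom (f : D.M₁) (m : M) :
    D.condExp (f * D.mulLeftHom m) = D.condExp f * m := by
  rw [condExp_apply, condExp_apply, smul_mul_assoc]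
  congr 1
  calc ∑ i, D.toEnd f (m * D.x i) * D.y i
      = ∑ i, ∑ j, D.toEnd f (D.x j) *
          (D.incl (D.E (D.y j * m * D.x i)) * D.y i) := by
        refine Finset.sum_congr rfl fun i _ => ?_
        rw [← D.sum_apply_mul_E f (m * D.x i), Finset.sum_mul]
        simp [mul_assoc]
    _ = (∑ j, D.toEnd f (D.x j) * D.y j) * m := by
        rw [Finset.sum_comm, Finset.sum_mul]
        refine Finset.sum_congr rfl fun j _ => ?_
        rw [← Finset.mul_sum, D.sum_E_mul, mul_assoc]

theorem jones_mul_jones : D.jones * D.jones = D.jones := by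
  refine M₁_ext fun m => ?_
  simp [D.E_incl]

/-- The basic construction: `M ↪ M₁` is again a strongly separable extension, with conditional
expectation `E_M`, dual bases `λ⁻¹ xᵢ e₁`, `e₁ yᵢ`, and the same index. -/
def basicConstruction : StronglySeparableExtension k M D.M₁ where
  incl := D.mulLeftHom
  E := D.condExp
  E_incl_mul := D.condExp_mulLeftHom_mul
  E_mul_incl := D.condExp_mul_mulLeftHom
  size := D.size
  x i := D.lam⁻¹ • (D.mulLeftHom (D.x i) * D.jones)
  y i := D.jones * D.mulLeftHom (D.y i)
  sum_E_mul f := by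
    have h : ∀ m, D.condExp (f * (D.mulLeftHom m * D.jones)) =
        D.lam • D.toEnd f m := fun m => by
      have h1 : ∑ j, D.incl (D.E (D.x j)) * D.y j = 1 := by simpa using D.sum_E_mul 1
      rw [condExp_apply, ← mul_one (D.toEnd f m), ← h1, Finset.mul_sum]
      congr 1
      refine Finset.sum_congr rfl fun j _ => ?_
      rw [← mul_assoc (D.toEnd f m), ← D.toEnd_mul_incl]
      simp
    refine M₁_ext fun m => ?_
    rw [← D.sum_apply_mul_E f m]
    simp only [h, map_smul, mul_smul_comm, smul_smul, inv_mul_cancel₀ D.lam_ne_zero, one_smul]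
    simp
  sum_mul_E f := by
    have h : ∀ m, D.condExp (D.jones * D.mulLeftHom m * f) =
        D.lam • ∑ j, D.incl (D.E (m * D.toEnd f (D.x j))) * D.y j := fun m => by
      simp [condExp_apply]
    refine M₁_ext fun m => ?_
    simp only [h, map_smul, mul_smul_comm, smul_mul_assoc, smul_smul,
      mul_inv_cancel₀ D.lam_ne_zero, one_smul]
    rw [← D.sum_apply_mul_E f m]
    simp only [map_sum, map_mul, LinearMap.sum_apply, Module.End.mul_apply, mulLeftHom_apply,
      jones_apply]
    simp only [D.E_incl_mul, map_mul]
    rw [Finset.sum_comm]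
    refine Finset.sum_congr rfl fun j _ => ?_
    conv_rhs => rw [← D.sum_mul_E (D.toEnd f (D.x j)), Finset.sum_mul]
    simp only [mul_assoc]
  E_one := by
    rw [condExp_apply]
    simp [D.sum_x_mul_y, Algebra.algebraMap_eq_smul_one, smul_smul, D.lam_ne_zero]
  lam := D.lam
  lam_ne_zero := D.lam_ne_zero
  sum_x_mul_y := by
    refine M₁_ext fun m => ?_
    simp only [smul_mul_assoc]
    rw [← Finset.smul_sum]
    have : ∀ i, D.mulLeftHom (D.x i) * D.jones * (D.jones * D.mulLeftHom (D.y i)) =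
        D.mulLeftHom (D.x i) * D.jones * D.mulLeftHom (D.y i) := fun i => by
      rw [mul_assoc, ← mul_assoc D.jones, jones_mul_jones, mul_assoc]
    simp [this, D.sum_mul_E, Algebra.algebraMap_eq_smul_one]

/-- The centralizer `C_M(N)` of `N` in `M`. -/
def centralizer : Subalgebra k M := Subalgebra.centralizer k (Set.range D.incl)

/-! ### The tower `N ↪ M ↪ M₁ ↪ M₂` -/

/-- The algebra `M₂`, the basic construction of `M ↪ M₁`. -/
abbrev M₂ : Type _ := D.basicConstruction.M₁

/-- The inclusion `M₁ ↪ M₂`. -/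
abbrev incl₂ : D.M₁ →ₐ[k] D.M₂ := D.basicConstruction.mulLeftHom

/-- The first Jones idempotent, as an element of `M₂`. -/
abbrev e₁ : D.M₂ := D.incl₂ D.jones

/-- The second Jones idempotent. -/
abbrev e₂ : D.M₂ := D.basicConstruction.jones

/-- The algebra `U = C_M(N)`. -/
abbrev U : Subalgebra k M := D.centralizer

/-- The algebra `V = C_{M₁}(M)`. -/
abbrev V : Subalgebra k D.M₁ := D.basicConstruction.centralizer

/-- The algebra `A = C_{M₁}(N)`. -/
abbrev A : Subalgebra k D.M₁ :=
  Subalgebra.centralizer k (Set.range (D.mulLeftHom.comp D.incl))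

/-- The algebra `B = C_{M₂}(M)`. -/
abbrev B : Subalgebra k D.M₂ :=
  Subalgebra.centralizer k (Set.range (D.incl₂.comp D.mulLeftHom))

variable (T : N →ₗ[k] k)

/-- `T₀ = T ∘ E` on `M`. -/
abbrev T₀ : M →ₗ[k] k := T ∘ₗ D.E

/-- `T₁ = T₀ ∘ E_M` on `M₁`. -/
abbrev T₁ : D.M₁ →ₗ[k] k := D.T₀ T ∘ₗ D.condExp

/-- `T₂ = T₁ ∘ E_{M₁}` on `M₂`. -/
abbrev T₂ : D.M₂ →ₗ[k] k := D.T₁ T ∘ₗ D.basicConstruction.condExp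

/-- `T` is a Markov trace: a normalized trace on `N` such that `T ∘ E` is a trace on `M`. -/
structure IsMarkovTrace : Prop where
  map_one : T 1 = 1
  map_mul_comm : ∀ n n', T (n * n') = T (n' * n)
  E_map_mul_comm : ∀ m m', D.T₀ T (m * m') = D.T₀ T (m' * m)

/-- `E(um) = E(mu)` for all `u ∈ U = C_M(N)` and `m ∈ M`. -/
def IsSymmetric : Prop := ∀ u ∈ D.U, ∀ m, D.E (u * m) = D.E (m * u)

/-- The map `φ : U → V`, `φ(u) = ∑ xᵢ u e₁ yᵢ`, here on all of `M`. -/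
def φ (u : M) : D.M₁ :=
  ∑ i, D.mulLeftHom (D.x i * u) * D.jones * D.mulLeftHom (D.y i)

/-- The symmetric product condition `∑ yᵢ xᵢ = λ⁻¹ 1 = ∑ xᵢ yᵢ` (the second equality is part of
the structure), or the identity `T₁ ∘ φ = T₀` on `U`. -/
def SymmetricProduct : Prop :=
  (∑ i, D.y i * D.x i = algebraMap k M D.lam⁻¹) ∨ ∀ u ∈ D.U, D.T₁ T (D.φ u) = D.T₀ T u

end StronglySeparableExtension

/-- `f = ∑ f⁽¹⁾ ⊗ f⁽²⁾` is a symmetric separability element of the algebra `R`: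
`∑ f⁽¹⁾ f⁽²⁾ = 1`, `∑ r f⁽¹⁾ ⊗ f⁽²⁾ = ∑ f⁽¹⁾ ⊗ f⁽²⁾ r`, and `∑ f⁽²⁾ ⊗ f⁽¹⁾ = f`. -/
structure IsSymmetricSeparabilityElement (k : Type*) {R : Type*} [Field k] [Ring R] [Algebra k R]
    (f : R ⊗[k] R) : Prop where
  mul_eq_one : LinearMap.mul' k R f = 1
  mul_comm : ∀ r : R, (r ⊗ₜ[k] (1 : R)) * f = f * ((1 : R) ⊗ₜ[k] r)
  symm : TensorProduct.comm k R R f = f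

/-- A Kanzaki separable algebra: one with a symmetric separability element. -/
def IsKanzakiSeparable (k R : Type*) [Field k] [Ring R] [Algebra k R] : Prop :=
  ∃ f : R ⊗[k] R, IsSymmetricSeparabilityElement k f

namespace StronglySeparableExtension

variable {k N M : Type*} [Field k] [Ring N] [Ring M] [Algebra k N] [Algebra k M]
  (D : StronglySeparableExtension k N M) (T : N →ₗ[k] k)

/-- `U` is Kanzaki separable and `T₀` restricts to a non-degenerate trace on it. -/
structure WeaklyIrreducible : Prop where
  kanzaki : IsKanzakiSeparable k D.U
  nondegenerate : ∀ u ∈ D.U, (∀ v ∈ D.U, D.T₀ T (u * v) = 0) → u = 0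

/-- `E : M → N` has dual bases in the subset `s` of `M`. -/
def HasDualBasesIn (s : Set M) : Prop :=
  ∃ (r : ℕ) (z w : Fin r → M), (∀ j, z j ∈ s ∧ w j ∈ s) ∧
    (∀ m, ∑ j, D.incl (D.E (m * z j)) * w j = m) ∧ ∀ m, ∑ j, z j * D.incl (D.E (w j * m)) = m

/-- The depth 2 property: `E_M` has dual bases in `A` and `E_{M₁}` has dual bases in `B`. -/
structure DepthTwo : Prop where
  dualBases_A : D.basicConstruction.HasDualBasesIn (D.A : Set D.M₁)
  dualBases_B : D.basicConstruction.basicConstruction.HasDualBasesIn (D.B : Set D.M₂)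

/-- `∑ f⁽¹⁾ ⊗ f⁽²⁾ ↦ ∑ f⁽¹⁾ T(f⁽²⁾)` on `V ⊗ V`. -/
def contractV : D.V ⊗[k] D.V →ₗ[k] D.V :=
  (TensorProduct.rid k D.V).toLinearMap ∘ₗ (D.T₁ T ∘ₗ D.V.val.toLinearMap).lTensor D.V

/-- The bilinear form `⟨a, b⟩ = λ⁻² T(a e₂ e₁ w b)` on `A × B`. -/
def pairing (w : D.V) : D.A →ₗ[k] D.B →ₗ[k] k :=
  LinearMap.mk₂ k
    (fun a b => D.lam⁻¹ ^ 2 * D.T₂ T (D.incl₂ a * D.e₂ * D.e₁ * D.incl₂ w * b))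
    (fun a a' b => by simp only [Subalgebra.coe_add, map_add, add_mul, mul_add])
    (fun c a b => by
      simp only [Subalgebra.coe_smul, map_smul, smul_mul_assoc, smul_eq_mul]; ring)
    (fun a b b' => by simp only [Subalgebra.coe_add, map_add, mul_add])
    (fun c a b => by
      simp only [Subalgebra.coe_smul, map_smul, mul_smul_comm, smul_eq_mul]; ring)

/-- The bilinear form `⟨a, b⟩' = λ⁻² T(b e₁ e₂ w a)` on `A × B`. -/
def pairing' (w : D.V) : D.A →ₗ[k] D.B →ₗ[k] k :=
  LinearMap.mk₂ k
    (fun a b => D.lam⁻¹ ^ 2 * D.T₂ T (b * D.e₁ * D.e₂ * D.incl₂ w * D.incl₂ a))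
    (fun a a' b => by simp only [Subalgebra.coe_add, map_add, mul_add])
    (fun c a b => by
      simp only [Subalgebra.coe_smul, map_smul, mul_smul_comm, smul_eq_mul]; ring)
    (fun a b b' => by simp only [Subalgebra.coe_add, map_add, add_mul, mul_add])
    (fun c a b => by
      simp only [Subalgebra.coe_smul, map_smul, smul_mul_assoc, smul_eq_mul]; ring)

/-- `b ⊗ b' ↦ ⟨a, b⟩⟨a', b'⟩`, for `a ⊗ a' ∈ A ⊗ A`. -/
def pairing₂ (w : D.V) : D.A ⊗[k] D.A →ₗ[k] Module.Dual k (D.B ⊗[k] D.B) :=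
  TensorProduct.dualDistrib k D.B D.B ∘ₗ
    TensorProduct.map (D.pairing T w) (D.pairing T w)

end StronglySeparableExtension

end Tower

/-! ### The algebra `A` acting on `M`: convolution and transposition. -/

noncomputable section EndomorphismAlgebra

namespace StronglySeparableExtension

variable {k N M : Type*} [Field k] [Ring N] [Ring M] [Algebra k N] [Algebra k M]
  (D : StronglySeparableExtension k N M) (T : N →ₗ[k] k)

/-! ### Casimir identities -/

/-! Everything is moved into the single algebra `A`, which acts on `M` as the `N`-bimodule
endomorphisms. Besides composition, `A` carries the convolution `(c * c')(m) = ∑ c(xᵢ) c'(yᵢ m)` and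
the transposition `a ↦ â` with `E(â(m) m') = E(m a(m'))`, which reverses both products. Since `M₁ =
M e₁ M`, an element of `B`, being an `M`-bimodule endomorphism of `M₁`, is determined by its value
at `e₁`, which lies in `A`. Followed by transposition this gives a linear bijection `kappa : B → A`
that takes the product of `B` to convolution. The form becomes `⟨a, b⟩ = λ⁻¹ tr(w a κ(b))`, where
`tr` is the trace of `M₁` on `A` and `w` acts by left multiplication by the corresponding element of
`U`. It is non-degenerate because `T₀` is so on `U` and `E_M` has dual bases in `A`.

Comultiplication: the dual bases provide, for each `a`, some `X` in `A ⊗ A` with `a(m m') = ∑ X₁(m)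
X₂(m')` (`DualBasesA.exists_represents`), so that `a ∘ (c * c') = ∑ (X₁ c) * (X₂ c')`. The trace of
a convolution factors through the separability element `∑ aⱼ ⊗ bⱼ` of `U` (`trA_mulU_w_conv`). Hence
`Δ(a) = Δ(1) X`, where `Δ(1) = ∑ r(bⱼ) ⊗ l(aⱼ)` and `l`, `r` denote left and right multiplication
(`comul_eq`). As `Δ(a)` again represents `a` and representing elements multiply, `Δ` is
multiplicative. The counit is `a ↦ T₀(w a(1))`, and the separability element supplies its axioms.

Antipode: with `c = w⁻¹`, the map `S(a)(m) = â(m w) c` is adjoint to `a` for the form `E(m m' w)`,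
and this yields the antipode axioms. Its compatibility with the pairing needs `tr(â) = tr(a)`
(`trA_transpose`), the least formal step: `tr(â) = tr(g a)` for some `g`, and `g` turns out to be
multiplicative on `M` with `E_M(g) = 1`, which forces `g = 1`.

Finally `B ≅ A*` as algebras, so `B` inherits the dual structure. `A` is semisimple because its
separability over `U` composes with that of `U` over `k` (`DualBasesA.isSemisimpleRing`). -/

/-- `∑ m xᵢ ⊗ yᵢ = ∑ xᵢ ⊗ yᵢ m` in `M ⊗_N M`. -/
theorem sum_balanced_mul_left {W : Type*} [AddCommGroup W] [Module k W] (Φ : M →ₗ[k] M →ₗ[k] W)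
    (hΦ : ∀ m n m', Φ (m * D.incl n) m' = Φ m (D.incl n * m')) (m : M) :
    ∑ i, Φ (m * D.x i) (D.y i) = ∑ i, Φ (D.x i) (D.y i * m) := by
  calc ∑ i, Φ (m * D.x i) (D.y i)
      = ∑ i, ∑ j, Φ (D.x j) (D.incl (D.E (D.y j * m * D.x i)) * D.y i) := by
        refine Finset.sum_congr rfl fun i _ => ?_
        conv_lhs => rw [← D.sum_mul_E (m * D.x i), map_sum, LinearMap.sum_apply]
        simp only [hΦ, mul_assoc]
    _ = ∑ i, Φ (D.x i) (D.y i * m) := by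
        rw [Finset.sum_comm]
        refine Finset.sum_congr rfl fun j _ => ?_
        rw [← map_sum, D.sum_E_mul]

theorem sum_apply_mul_left (F G : M →ₗ[k] M) (hF : ∀ m n, F (m * D.incl n) = F m * D.incl n)
    (hG : ∀ n m, G (D.incl n * m) = D.incl n * G m) (m : M) :
    ∑ i, F (m * D.x i) * G (D.y i) = ∑ i, F (D.x i) * G (D.y i * m) := by
  have := D.sum_balanced_mul_left ((LinearMap.mul k M).compl₁₂ F G)
    (fun m n m' => by simp [hF, hG, mul_assoc]) m
  simpa using this

theorem E_ext_left {m m' : M} (h : ∀ y, D.E (y * m) = D.E (y * m')) : m = m' := by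
  rw [← D.sum_mul_E m, ← D.sum_mul_E m']
  simp only [h]

theorem E_ext_right {m m' : M} (h : ∀ y, D.E (m * y) = D.E (m' * y)) : m = m' := by
  rw [← D.sum_E_mul m, ← D.sum_E_mul m']
  simp only [h]

theorem sum_E_mul_y : ∑ i, D.incl (D.E (D.x i)) * D.y i = 1 := by simpa using D.sum_E_mul 1

/-- Right `N`-linearity gives `f m e₁ = f(m) e₁`, and `E_M(e₁) = λ`. -/
theorem condExp_mul_jones (f : D.M₁) (m : M) :
    D.condExp (f * D.mulLeftHom m * D.jones) = D.lam • D.toEnd f m := by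
  rw [condExp_apply, ← mul_one (D.toEnd f m), ← D.sum_E_mul_y, Finset.mul_sum]
  congr 1
  refine Finset.sum_congr rfl fun j _ => ?_
  rw [← mul_assoc (D.toEnd f m), ← D.toEnd_mul_incl]
  simp

theorem sum_mul_jones_mul (f : D.M₁) :
    ∑ i, D.mulLeftHom (D.toEnd f (D.x i)) * D.jones * D.mulLeftHom (D.y i) = f := by
  refine M₁_ext fun m => ?_
  simp [D.sum_apply_mul_E]

/-! ### The centralizers `U` and `A` -/

theorem mem_U {u : M} : u ∈ D.U ↔ ∀ n, D.incl n * u = u * D.incl n := by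
  simp [centralizer, Subalgebra.mem_centralizer_iff]

theorem incl_mul_U (u : D.U) (n : N) : D.incl n * (u : M) = u * D.incl n := D.mem_U.1 u.2 n

/-- Right `N`-linearity is built into `M₁`; commuting with `N` adds left linearity. Thus `A` is the
algebra of `N`-bimodule endomorphisms of `M` and can be studied through its action. -/
theorem mem_A {f : D.M₁} :
    f ∈ D.A ↔ ∀ n m, D.toEnd f (D.incl n * m) = D.incl n * D.toEnd f m := by
  rw [Subalgebra.mem_centralizer_iff]
  constructor
  · intro h n m
    have := congrArg (fun g => D.toEnd g m) (h _ ⟨n, rfl⟩)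
    simpa using this.symm
  · rintro h _ ⟨n, rfl⟩
    exact M₁_ext fun m => by simp [h]

/-- The action of `A` on `M`, as the `N`-bimodule endomorphisms. -/
def act : D.A →ₐ[k] Module.End k M := D.toEnd.comp D.A.val

theorem toEnd_coe_A (a : D.A) : D.toEnd (a : D.M₁) = D.act a := rfl

variable {D} in
theorem A_ext {a b : D.A} (h : ∀ m, D.act a m = D.act b m) : a = b :=
  Subtype.ext (M₁_ext h)

@[simp] theorem act_mul_apply (a b : D.A) (m : M) : D.act (a * b) m = D.act a (D.act b m) := by
  simp

theorem act_mul_incl (a : D.A) (m : M) (n : N) :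
    D.act a (m * D.incl n) = D.act a m * D.incl n := D.toEnd_mul_incl _ m n

theorem act_incl_mul (a : D.A) (n : N) (m : M) :
    D.act a (D.incl n * m) = D.incl n * D.act a m := D.mem_A.1 a.2 n m

theorem act_mem_U (a : D.A) (u : D.U) : D.act a u ∈ D.U := by
  rw [mem_U]
  intro n
  rw [← act_incl_mul, incl_mul_U, act_mul_incl]

/-- The element of `A` given by an `N`-bimodule endomorphism of `M`. -/
def mkA (f : M →ₗ[k] M) (hr : ∀ m n, f (m * D.incl n) = f m * D.incl n)
    (hl : ∀ n m, f (D.incl n * m) = D.incl n * f m) : D.A :=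
  ⟨(⟨f, hr⟩ : D.endRight), D.mem_A.2 hl⟩

@[simp] theorem act_mkA (f : M →ₗ[k] M) (hr hl) (m : M) : D.act (D.mkA f hr hl) m = f m := rfl

/-- Left multiplication by elements of `U`. -/
def mulU : D.U →ₗ[k] D.A where
  toFun u := D.mkA (LinearMap.mulLeft k (u : M)) (fun m n => by simp [mul_assoc])
    (fun n m => by simp [← mul_assoc, D.incl_mul_U])
  map_add' u v := A_ext fun m => by rw [map_add]; exact add_mul (u : M) v m
  map_smul' c u := A_ext fun m => by rw [map_smul]; exact smul_mul_assoc c (u : M) m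

/-- Right multiplication by elements of `U`. -/
def mulRightU : D.U →ₗ[k] D.A where
  toFun u := D.mkA (LinearMap.mulRight k (u : M)) (fun m n => by simp [mul_assoc, D.incl_mul_U])
    (fun n m => by simp [mul_assoc])
  map_add' u v := A_ext fun m => by rw [map_add]; exact mul_add m (u : M) v
  map_smul' c u := A_ext fun m => by rw [map_smul]; exact mul_smul_comm c m (u : M)

@[simp] theorem act_mulU (u : D.U) (m : M) : D.act (D.mulU u) m = u * m := rfl

@[simp] theorem act_mulRightU (u : D.U) (m : M) : D.act (D.mulRightU u) m = m * u := rfl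

/-- The Jones idempotent as an element of `A`. -/
def jonesA : D.A := D.mkA (D.incl.toLinearMap ∘ₗ D.E) (fun m n => by simp [D.E_mul_incl])
  (fun n m => by simp [D.E_incl_mul])

@[simp] theorem act_jonesA (m : M) : D.act D.jonesA m = D.incl (D.E m) := rfl

theorem sum_act_apply_mul (a b : D.A) (m : M) :
    ∑ i, D.act a (m * D.x i) * D.act b (D.y i) = ∑ i, D.act a (D.x i) * D.act b (D.y i * m) :=
  D.sum_apply_mul_left (D.act a) (D.act b) (D.act_mul_incl a) (D.act_incl_mul b) m

theorem sum_act_mul (a : D.A) (m : M) :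
    ∑ i, D.act a (m * D.x i) * D.y i = ∑ i, D.act a (D.x i) * (D.y i * m) := by
  simpa using D.sum_act_apply_mul a 1 m

/-- The convolution product of bimodule endomorphisms, `(c * c')(m) = ∑ c(xᵢ) c'(yᵢ m)`. -/
def conv (c c' : D.A) : D.A :=
  D.mkA (∑ i, LinearMap.mulLeft k (D.act c (D.x i)) ∘ₗ D.act c' ∘ₗ LinearMap.mulLeft k (D.y i))
    (fun m n => by simp [← mul_assoc, D.act_mul_incl, Finset.sum_mul])
    (fun n m => by
      -- Left linearity is visible only after the Casimir identity moves the argument to the other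
      -- factor, `∑ c(m xᵢ) c'(yᵢ)`.
      have h := D.sum_act_apply_mul c c' (D.incl n * m)
      have h' := D.sum_act_apply_mul c c' m
      simp only [LinearMap.sum_apply, LinearMap.comp_apply, LinearMap.mulLeft_apply]
      rw [← h, ← h', Finset.mul_sum]
      simp only [mul_assoc, D.act_incl_mul])

theorem act_conv (c c' : D.A) (m : M) :
    D.act (D.conv c c') m = ∑ i, D.act c (D.x i) * D.act c' (D.y i * m) := by
  simp [conv]

theorem act_conv' (c c' : D.A) (m : M) :
    D.act (D.conv c c') m = ∑ i, D.act c (m * D.x i) * D.act c' (D.y i) := by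
  rw [act_conv, sum_act_apply_mul]

/-- The conditional expectation `E_M`, restricted to a map `A → U`. -/
def expA : D.A →ₗ[k] D.U :=
  (D.condExp ∘ₗ D.A.val.toLinearMap).codRestrict (Subalgebra.toSubmodule D.U) fun a => by
    rw [Subalgebra.mem_toSubmodule, mem_U]
    intro n
    have h : D.mulLeftHom (D.incl n) * (a : D.M₁) = a * D.mulLeftHom (D.incl n) :=
      Subalgebra.mem_centralizer_iff k |>.1 a.2 _ ⟨n, rfl⟩
    simp only [LinearMap.comp_apply, AlgHom.toLinearMap_apply, Subalgebra.coe_val]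
    rw [← condExp_mulLeftHom_mul, h, condExp_mul_mulLeftHom]

theorem coe_expA (a : D.A) : (D.expA a : M) = D.condExp (a : D.M₁) := rfl

theorem expA_eq (a : D.A) : (D.expA a : M) = D.lam • ∑ i, D.act a (D.x i) * D.y i := by
  rw [coe_expA, condExp_apply]; rfl

theorem expA_mul (a : D.A) (m : M) :
    D.lam • ∑ i, D.act a (m * D.x i) * D.y i = D.expA a * m := by
  rw [D.sum_act_mul, expA_eq, smul_mul_assoc, Finset.sum_mul]
  simp only [mul_assoc]

theorem expA_mulU_mul (u : D.U) (a : D.A) : (D.expA (D.mulU u * a) : M) = u * D.expA a := by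
  simp [expA_eq, Finset.mul_sum, mul_assoc]

/-- The transpose of a bimodule endomorphism with respect to the form `E(xy)`. -/
def transpose : D.A →ₗ[k] D.A where
  toFun a := D.mkA (∑ j, LinearMap.mulRight k (D.y j) ∘ₗ D.incl.toLinearMap ∘ₗ D.E ∘ₗ
      LinearMap.mulRight k (D.act a (D.x j)))
    (fun m n => by
      -- The Casimir identity carries `n` from the right of `yⱼ` to the left of `xⱼ`, where `a` lets
      -- it pass to `m`.
      have := D.sum_balanced_mul_left
        ((LinearMap.mul k M).compl₁₂ (D.incl.toLinearMap ∘ₗ D.E ∘ₗ LinearMap.mulLeft k m ∘ₗ D.act a)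
          LinearMap.id) (fun m n m' => by
            simp [D.act_mul_incl, ← mul_assoc, D.E_mul_incl]) (D.incl n)
      simp only [LinearMap.compl₁₂_apply, LinearMap.mul_apply', LinearMap.id_apply,
        LinearMap.comp_apply, AlgHom.toLinearMap_apply, LinearMap.mulLeft_apply, D.act_incl_mul,
        ← mul_assoc] at this
      simpa [Finset.sum_mul] using this)
    (fun n m => by simp [Finset.mul_sum, mul_assoc, D.E_incl_mul])
  map_add' a b := A_ext fun m => by simp [mul_add, add_mul, Finset.sum_add_distrib]
  map_smul' c a := A_ext fun m => by simp [Finset.smul_sum]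

theorem act_transpose (a : D.A) (m : M) :
    D.act (D.transpose a) m = ∑ j, D.incl (D.E (m * D.act a (D.x j))) * D.y j := by
  simp [transpose]

theorem E_transpose_mul (a : D.A) (m m' : M) :
    D.E (D.act (D.transpose a) m * m') = D.E (m * D.act a m') := by
  conv_rhs => rw [← D.sum_mul_E m']
  simp [act_transpose, Finset.sum_mul, Finset.mul_sum, mul_assoc, D.E_incl_mul, D.act_mul_incl]
  simp only [← mul_assoc, D.E_mul_incl]

/-- The form `E(m m')` is non-degenerate, so identities between transposes need only be tested
inside it. -/
theorem eq_transpose {a b : D.A}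
    (h : ∀ m m', D.E (D.act b m * m') = D.E (m * D.act a m')) : b = D.transpose a :=
  A_ext fun m => D.E_ext_right fun y => by rw [h, E_transpose_mul]

theorem transpose_mul (a b : D.A) :
    D.transpose (a * b) = D.transpose b * D.transpose a :=
  (D.eq_transpose fun m m' => by simp [E_transpose_mul]).symm

theorem transpose_mulU (u : D.U) : D.transpose (D.mulU u) = D.mulRightU u :=
  (D.eq_transpose fun m m' => by simp [mul_assoc]).symm

/-- Here `u` has to move cyclically inside `E`, which is the symmetry hypothesis; for left
multiplications associativity suffices. -/
theorem transpose_mulRightU (hs : D.IsSymmetric) (u : D.U) :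
    D.transpose (D.mulRightU u) = D.mulU u :=
  (D.eq_transpose fun m m' => by simp [mul_assoc, hs u u.2]).symm

theorem transpose_jonesA : D.transpose D.jonesA = D.jonesA :=
  (D.eq_transpose fun m m' => by simp [D.E_incl_mul, D.E_mul_incl]).symm

/-- `∑ c(xᵢ) ⊗ yᵢ = ∑ xᵢ ⊗ ĉ(yᵢ)` in `M ⊗_N M`. -/
theorem sum_balanced_act {W : Type*} [AddCommGroup W] [Module k W] (Φ : M →ₗ[k] M →ₗ[k] W)
    (hΦ : ∀ m n m', Φ (m * D.incl n) m' = Φ m (D.incl n * m')) (c : D.A) :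
    ∑ i, Φ (D.act c (D.x i)) (D.y i) = ∑ i, Φ (D.x i) (D.act (D.transpose c) (D.y i)) := by
  calc ∑ i, Φ (D.act c (D.x i)) (D.y i)
      = ∑ i, ∑ j, Φ (D.x j) (D.incl (D.E (D.y j * D.act c (D.x i))) * D.y i) := by
        refine Finset.sum_congr rfl fun i _ => ?_
        conv_lhs => rw [← D.sum_mul_E (D.act c (D.x i)), map_sum, LinearMap.sum_apply]
        simp only [hΦ]
    _ = _ := by
        rw [Finset.sum_comm]
        refine Finset.sum_congr rfl fun j _ => ?_
        rw [← map_sum, act_transpose]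

/-- The balanced tensor `∑ xᵢ ⊗ yᵢ` turns `ĉ` on the second leg into `c` on the first; then `ĉ'` is
removed by adjunction. -/
theorem transpose_conv (c c' : D.A) :
    D.transpose (D.conv c c') = D.conv (D.transpose c') (D.transpose c) := by
  symm
  refine D.eq_transpose fun m m' => ?_
  have h := D.sum_balanced_act
    ((LinearMap.mul k M).compl₁₂ (D.act (D.transpose c') ∘ₗ LinearMap.mulLeft k m) LinearMap.id)
    (fun m n m' => by simp [← mul_assoc, D.act_mul_incl]) c
  simp only [LinearMap.compl₁₂_apply, LinearMap.mul_apply', LinearMap.id_apply,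
        LinearMap.comp_apply, LinearMap.mulLeft_apply] at h
  rw [act_conv', ← h, act_conv, Finset.sum_mul, Finset.mul_sum, map_sum, map_sum]
  refine Finset.sum_congr rfl fun i _ => ?_
  rw [mul_assoc, E_transpose_mul, mul_assoc]

end StronglySeparableExtension

end EndomorphismAlgebra

/-! ### Symmetric separability elements and non-degenerate traces. -/

noncomputable section SymmetricSeparability

section

variable {k R : Type*} [Field k] [Ring R] [Algebra k R]

theorem isSymmetricSeparabilityElement_sum_iff {ι : Type*} [Fintype ι] (a b : ι → R) :
    IsSymmetricSeparabilityElement k (∑ j, a j ⊗ₜ[k] b j) ↔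
      ∑ j, a j * b j = 1 ∧ (∀ r, ∑ j, (r * a j) ⊗ₜ[k] b j = ∑ j, a j ⊗ₜ[k] (b j * r)) ∧
        ∑ j, b j ⊗ₜ[k] a j = ∑ j, a j ⊗ₜ[k] b j := by
  constructor
  · rintro ⟨h₁, h₂, h₃⟩
    exact ⟨by simpa using h₁, by simpa [Finset.mul_sum, Finset.sum_mul] using h₂,
      by simpa using h₃⟩
  · rintro ⟨h₁, h₂, h₃⟩
    exact ⟨by simpa using h₁, by simpa [Finset.mul_sum, Finset.sum_mul] using h₂,
      by simpa using h₃⟩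

namespace IsSymmetricSeparabilityElement

section Sum

variable {ι : Type*} [Fintype ι] {a b : ι → R}
  (hf : IsSymmetricSeparabilityElement k (∑ j, a j ⊗ₜ[k] b j))

include hf

theorem sum_mul : ∑ j, a j * b j = 1 := ((isSymmetricSeparabilityElement_sum_iff a b).1 hf).1

theorem sum_mul_tmul (r : R) : ∑ j, (r * a j) ⊗ₜ[k] b j = ∑ j, a j ⊗ₜ[k] (b j * r) :=
  ((isSymmetricSeparabilityElement_sum_iff a b).1 hf).2.1 r

theorem sum_swap : ∑ j, b j ⊗ₜ[k] a j = ∑ j, a j ⊗ₜ[k] b j :=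
  ((isSymmetricSeparabilityElement_sum_iff a b).1 hf).2.2

theorem sum_mul_swap : ∑ j, b j * a j = 1 := by
  simpa [hf.sum_mul] using congrArg (LinearMap.mul' k R) hf.sum_swap

/-- Flip invariance converts the identity for the outer bimodule structure into one for the inner
structure. -/
theorem sum_tmul_mul (r : R) : ∑ j, (a j * r) ⊗ₜ[k] b j = ∑ j, a j ⊗ₜ[k] (r * b j) := by
  have h₁ := congrArg ((LinearMap.mulRight k r).rTensor R) hf.sum_swap
  have h₂ := congrArg ((LinearMap.mulLeft k r).lTensor R) hf.sum_swap
  have h₃ := congrArg (TensorProduct.comm k R R) (hf.sum_mul_tmul r)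
  simp only [map_sum, LinearMap.rTensor_tmul, LinearMap.lTensor_tmul, LinearMap.mulRight_apply,
    LinearMap.mulLeft_apply, TensorProduct.comm_tmul] at h₁ h₂ h₃
  rw [← h₁, ← h₂, h₃]

/-- A separable algebra over a field is finite dimensional. -/
theorem finite_of_sum : Module.Finite k R := by
  let W := Submodule.span k (Set.range b)
  obtain ⟨q, hq⟩ := W.subtype.exists_leftInverse_of_injective (by simp)
  have hq' (j) : (q (b j) : R) = b j := congrArg Subtype.val
    (LinearMap.congr_fun hq ⟨b j, Submodule.subset_span ⟨j, rfl⟩⟩)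
  -- Apply the projection `q` to the second leg of `r f = f r`, where `q` fixes each `bⱼ`. Then `r`
  -- is determined by finitely many vectors of the finite-dimensional space `W`.
  have key (r : R) : r = ∑ j, a j * q (b j * r) := by
    have h := congrArg (LinearMap.mul' k R)
      (congrArg ((W.subtype ∘ₗ q).lTensor R) (hf.sum_mul_tmul r))
    simp only [map_sum, LinearMap.lTensor_tmul, LinearMap.comp_apply, Submodule.subtype_apply,
      LinearMap.mul'_apply, hq', mul_assoc] at h
    rwa [← Finset.mul_sum, hf.sum_mul, mul_one] at h
  have : Module.Finite k W := Module.Finite.span_of_finite k (Set.finite_range b)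
  refine Module.Finite.of_surjective
    (∑ j, LinearMap.mulLeft k (a j) ∘ₗ W.subtype ∘ₗ LinearMap.proj j : (ι → W) →ₗ[k] R)
    fun r => ⟨fun j => q (b j * r), ?_⟩
  simpa using (key r).symm

end Sum

/-- A symmetric separability element is unique. -/
theorem unique {f f' : R ⊗[k] R} (hf : IsSymmetricSeparabilityElement k f)
    (hf' : IsSymmetricSeparabilityElement k f') : f' = f := by
  obtain ⟨n, a, b, rfl⟩ := TensorProduct.exists_sum_tmul_eq f
  obtain ⟨n', a', b', rfl⟩ := TensorProduct.exists_sum_tmul_eq f'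
  have h₁ (i) : ∑ j, (a i * a' j) ⊗ₜ[k] (b' j * b i) = ∑ j, a' j ⊗ₜ[k] (b' j * (a i * b i)) := by
    simpa [mul_assoc] using congrArg ((LinearMap.mulRight k (b i)).lTensor R)
      (hf'.sum_mul_tmul (a i))
  have h₂ (j) : ∑ i, (a i * a' j) ⊗ₜ[k] (b' j * b i) = ∑ i, a i ⊗ₜ[k] (b' j * a' j * b i) := by
    simpa [mul_assoc] using congrArg ((LinearMap.mulLeft k (b' j)).lTensor R)
      (hf.sum_tmul_mul (a' j))
  -- The interleaved double sum collapses to either element: to one by `∑ aᵢ bᵢ = 1`, to the other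
  -- by `∑ b'ⱼ a'ⱼ = 1`.
  calc ∑ j, a' j ⊗ₜ[k] b' j = ∑ i, ∑ j, (a i * a' j) ⊗ₜ[k] (b' j * b i) := by
        simp only [h₁]
        rw [Finset.sum_comm]
        simp only [← TensorProduct.tmul_sum, ← Finset.mul_sum, hf.sum_mul, mul_one]
    _ = ∑ i, a i ⊗ₜ[k] b i := by
        rw [Finset.sum_comm]
        simp only [h₂]
        rw [Finset.sum_comm]
        simp only [← TensorProduct.tmul_sum, ← Finset.sum_mul, hf'.sum_mul_swap, one_mul]

end IsSymmetricSeparabilityElement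

theorem IsKanzakiSeparable.finite (h : IsKanzakiSeparable k R) : Module.Finite k R := by
  obtain ⟨f, hf⟩ := h
  obtain ⟨n, a, b, rfl⟩ := TensorProduct.exists_sum_tmul_eq f
  exact hf.finite_of_sum

/-- A symmetric separability element `∑ aⱼ ⊗ bⱼ` of an algebra with a trace `τ`, such that
`∑ aⱼ τ(bⱼ)` is invertible, with inverse `w`. -/
structure TraceCasimir (τ : R →ₗ[k] k) where
  size : ℕ
  a : Fin size → R
  b : Fin size → R
  isSep : IsSymmetricSeparabilityElement k (∑ j, a j ⊗ₜ[k] b j)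
  w : R
  w_mul : w * ∑ j, τ (b j) • a j = 1
  mul_w : (∑ j, τ (b j) • a j) * w = 1
  w_comm : ∀ v, w * v = v * w
  sum_smul_a : ∀ v, ∑ j, τ (w * (v * b j)) • a j = v
  sum_smul_b : ∀ v, ∑ j, τ (w * (a j * v)) • b j = v

/-- The element `c = ∑ τ(bⱼ) aⱼ` is central, since `v c = ∑ τ(bⱼ v) aⱼ = c v`. A basis `eᵢ` and its
`τ`-dual family `rᵢ` give the inverse `w = ∑ rᵢ eᵢ`, because `c w = ∑ aⱼ bⱼ = 1`. The reproducing
formulas then spell out `(v w) c = v`. -/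
theorem IsKanzakiSeparable.exists_traceCasimir (h : IsKanzakiSeparable k R) (τ : R →ₗ[k] k)
    (hτ : ∀ u v, τ (u * v) = τ (v * u)) (hnd : ∀ u, (∀ v, τ (u * v) = 0) → u = 0) :
    Nonempty (TraceCasimir τ) := by
  have := h.finite
  obtain ⟨f, hf⟩ := h
  obtain ⟨n, a, b, rfl⟩ := TensorProduct.exists_sum_tmul_eq f
  set c := ∑ j, τ (b j) • a j with hc
  have mul_c (v : R) : v * c = ∑ j, τ (b j * v) • a j := by
    simpa [hc, Finset.mul_sum] using congrArg (TensorProduct.rid k R)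
      (congrArg (τ.lTensor R) (hf.sum_mul_tmul v))
  have c_mul (v : R) : c * v = ∑ j, τ (b j * v) • a j := by
    simpa [hc, Finset.sum_mul, hτ _ v] using congrArg (TensorProduct.rid k R)
      (congrArg (τ.lTensor R) (hf.sum_tmul_mul v))
  let β : R →ₗ[k] Module.Dual k R := (LinearMap.mul k R).compr₂ τ
  have hβ : Function.Surjective β := by
    refine (LinearMap.injective_iff_surjective_of_finrank_eq_finrank
      Subspace.dual_finrank_eq.symm).1
      ((injective_iff_map_eq_zero β).2 fun u hu => hnd u fun v => ?_)
    exact LinearMap.congr_fun hu v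
  let e := Module.finBasis k R
  choose r hr using fun i => hβ (e.coord i)
  have hr' (v : R) : ∑ i, τ (r i * v) • e i = v := by
    conv_rhs => rw [← e.sum_repr v]
    exact Finset.sum_congr rfl fun i _ => by rw [← e.coord_apply, ← hr i]; rfl
  have hcw : c * ∑ i, r i * e i = 1 := by
    have h (i) : c * (r i * e i) = ∑ j, τ (b j * r i) • (a j * e i) := by
      rw [← mul_assoc, c_mul, Finset.sum_mul]
      simp only [smul_mul_assoc]
    simp only [Finset.mul_sum, h]
    rw [Finset.sum_comm, ← hf.sum_mul]
    refine Finset.sum_congr rfl fun j _ => ?_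
    conv_rhs => rw [← hr' (b j), Finset.mul_sum]
    exact Finset.sum_congr rfl fun i _ => by rw [hτ, mul_smul_comm]
  set w := ∑ i, r i * e i with hw
  have hwc : w * c = 1 := by rw [mul_c, ← c_mul, hcw]
  have w_comm (v : R) : w * v = v * w := by
    calc w * v = w * (v * c) * w := by rw [mul_assoc, mul_assoc v, hcw, mul_one]
      _ = v * w := by rw [mul_c, ← c_mul, ← mul_assoc, hwc, one_mul]
  have hK (v : R) : ∑ j, τ (b j * (v * w)) • a j = v := by
    rw [← mul_c, mul_assoc, hwc, mul_one]
  refine ⟨⟨n, a, b, hf, w, hwc, hcw, w_comm, fun v => ?_, fun v => ?_⟩⟩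
  · conv_rhs => rw [← hK v]
    exact Finset.sum_congr rfl fun j _ => by rw [w_comm, mul_assoc, hτ, mul_assoc, w_comm]
  · have h := congrArg (TensorProduct.rid k R)
      (congrArg ((τ ∘ₗ LinearMap.mulRight k (v * w)).lTensor R) hf.sum_swap)
    simp only [map_sum, LinearMap.lTensor_tmul, LinearMap.comp_apply, LinearMap.mulRight_apply,
      TensorProduct.rid_tmul, hK] at h
    exact (Finset.sum_congr rfl fun j _ => by rw [w_comm, mul_assoc]).trans h

end

end SymmetricSeparability

/-! ### The trace on `A` and its invariance under transposition. -/

noncomputable section TraceOnCentralizer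

namespace StronglySeparableExtension

variable {k N M : Type*} [Field k] [Ring N] [Ring M] [Algebra k N] [Algebra k M]
  (D : StronglySeparableExtension k N M) (T : N →ₗ[k] k)

theorem T₁_apply (f : D.M₁) : D.T₁ T f = D.lam * ∑ i, D.T₀ T (D.toEnd f (D.x i) * D.y i) := by
  simp [condExp_apply]

variable {T} in
-- Up to the factor `λ` this is the trace of a product of matrices with entries `E(yᵢ f(xⱼ))` in
-- `N`, so the trace property of `T` is enough.
theorem IsMarkovTrace.T₁_mul_comm {D : StronglySeparableExtension k N M} (hT : D.IsMarkovTrace T)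
    (f g : D.M₁) : D.T₁ T (f * g) = D.T₁ T (g * f) := by
  have key (f g : D.M₁) (i) : D.T₀ T (D.toEnd (f * g) (D.x i) * D.y i) =
      ∑ j, T (D.E (D.y i * D.toEnd f (D.x j)) * D.E (D.y j * D.toEnd g (D.x i))) := by
    rw [map_mul D.toEnd, Module.End.mul_apply, ← D.sum_apply_mul_E f, Finset.sum_mul, map_sum]
    refine Finset.sum_congr rfl fun j _ => ?_
    rw [hT.E_map_mul_comm, ← mul_assoc, LinearMap.comp_apply, D.E_mul_incl]
  rw [T₁_apply, T₁_apply]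
  simp only [key]
  rw [Finset.sum_comm]
  simp only [hT.map_mul_comm]

/-- The restriction to `A` of the trace of `M₁`. -/
def trA : D.A →ₗ[k] k := D.T₁ T ∘ₗ D.A.val.toLinearMap

theorem trA_eq_T₁ (a : D.A) : D.trA T a = D.T₁ T a := rfl

theorem trA_apply (a : D.A) :
    D.trA T a = D.lam * ∑ i, D.T₀ T (D.act a (D.x i) * D.y i) := D.T₁_apply T a

theorem trA_eq_expA (a : D.A) : D.trA T a = D.T₀ T (D.expA a) := rfl

theorem trA_mulU_mul (u : D.U) (a : D.A) :
    D.trA T (D.mulU u * a) = D.T₀ T (u * D.expA a) := by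
  rw [trA_eq_expA, expA_mulU_mul]

variable {D T}

theorem IsMarkovTrace.trA_mul_comm (hT : D.IsMarkovTrace T) (a b : D.A) :
    D.trA T (a * b) = D.trA T (b * a) := hT.T₁_mul_comm _ _

/-- In `xᵢ u E(yᵢ m)` the element `u` commutes past `E(yᵢ m)`. This brings the second alternative of
the symmetric product hypothesis into terms of `A`. -/
theorem coe_mulRightU (u : D.U) : (D.mulRightU u : D.M₁) = D.φ u := by
  refine M₁_ext fun m => ?_
  have h (i) : D.x i * (u * D.incl (D.E (D.y i * m))) =
      D.x i * D.incl (D.E (D.y i * m)) * u := by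
    rw [← incl_mul_U, mul_assoc]
  rw [toEnd_coe_A, act_mulRightU]
  simp [φ, h, mul_assoc]
  simp [← mul_assoc, ← Finset.sum_mul, D.sum_mul_E]

/-- The only form in which the hypothesis is needed. In the first alternative cyclicity of `T₀`
turns `∑ xᵢ u yᵢ` into `(∑ yᵢ xᵢ) u`. -/
theorem SymmetricProduct.trA_mulRightU (hp : D.SymmetricProduct T) (hT : D.IsMarkovTrace T)
    (u : D.U) : D.trA T (D.mulRightU u) = D.T₀ T u := by
  rcases hp with h | h
  · rw [trA_apply]
    simp only [act_mulRightU]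
    simp only [hT.E_map_mul_comm _ (D.y _), ← mul_assoc]
    rw [← map_sum, ← Finset.sum_mul, h, ← Algebra.smul_def, map_smul, smul_eq_mul,
      mul_inv_cancel_left₀ D.lam_ne_zero]
  · rw [trA_eq_T₁, coe_mulRightU, h u u.2]

theorem coe_conv (c c' : D.A) : (D.conv c c' : D.M₁) =
    ∑ i, D.mulLeftHom (D.act c (D.x i)) * c' * D.mulLeftHom (D.y i) := by
  refine M₁_ext fun m => ?_
  rw [toEnd_coe_A, act_conv]
  simp [toEnd_coe_A]

theorem coe_expA_conv (c c' : D.A) :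
    (D.expA (D.conv c c') : M) = ∑ i, D.act c (D.x i) * D.expA c' * D.y i := by
  rw [expA_eq]
  simp only [act_conv, Finset.sum_mul]
  rw [Finset.sum_comm, Finset.smul_sum]
  refine Finset.sum_congr rfl fun i _ => ?_
  rw [mul_assoc, ← expA_mul]
  simp only [mul_assoc, ← Finset.mul_sum, mul_smul_comm]

/-- Both sides come from `∑ c(xᵢ) E_M(c') yᵢ`: under `E_M`, a convolution depends on its second
factor only through an element of `U`. -/
theorem lam_smul_expA_conv (c c' : D.A) :
    D.lam • (D.expA (D.conv c c') : M) = D.expA (D.mulRightU (D.expA c') * c) := by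
  rw [coe_expA_conv, D.expA_eq (_ * c)]
  simp only [act_mul_apply, act_mulRightU]

theorem trA_conv (c c' : D.A) :
    D.lam * D.trA T (D.conv c c') = D.trA T (D.mulRightU (D.expA c') * c) := by
  rw [trA_eq_expA, trA_eq_expA, ← smul_eq_mul, ← map_smul, lam_smul_expA_conv]

/-- A family of dual bases of `E_M` in `A`. -/
structure DualBasesA (D : StronglySeparableExtension k N M) where
  size : ℕ
  z : Fin size → D.A
  w : Fin size → D.A
  sum_condExp_mul : ∀ f : D.M₁, ∑ j, D.mulLeftHom (D.condExp (f * z j)) * w j = f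
  sum_mul_condExp : ∀ f : D.M₁, ∑ j, z j * D.mulLeftHom (D.condExp (w j * f)) = f

theorem DepthTwo.nonempty_dualBasesA (h : D.DepthTwo) : Nonempty D.DualBasesA := by
  obtain ⟨r, z, w, hzw, h₁, h₂⟩ := h.dualBases_A
  exact ⟨⟨r, fun j => ⟨z j, (hzw j).1⟩, fun j => ⟨w j, (hzw j).2⟩, h₁, h₂⟩⟩

theorem DualBasesA.sum_mulU_mul (Z : D.DualBasesA) (a : D.A) :
    ∑ j, D.mulU (D.expA (a * Z.z j)) * Z.w j = a :=
  Subtype.ext <| by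
    conv_rhs => rw [← Z.sum_condExp_mul a]
    simp only [AddSubmonoidClass.coe_finsetSum]
    rfl

theorem DualBasesA.sum_mul_mulU (Z : D.DualBasesA) (a : D.A) :
    ∑ j, Z.z j * D.mulU (D.expA (Z.w j * a)) = a :=
  Subtype.ext <| by
    conv_rhs => rw [← Z.sum_mul_condExp a]
    simp only [AddSubmonoidClass.coe_finsetSum]
    rfl

theorem DualBasesA.finite (Z : D.DualBasesA) [Module.Finite k D.U] : Module.Finite k D.A :=
  Module.Finite.of_surjective
    (∑ j, LinearMap.mulRight k (Z.w j) ∘ₗ D.mulU ∘ₗ LinearMap.proj j :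
      (Fin Z.size → D.U) →ₗ[k] D.A)
    fun a => ⟨fun j => D.expA (a * Z.z j), by simpa using Z.sum_mulU_mul a⟩

/-- Tracing against `zⱼ v` with `v` in `U` tests the coefficient `E_M(a zⱼ)` of `a` against `v`
under `T₀`, so all coefficients vanish. -/
theorem DualBasesA.trA_nondegenerate (Z : D.DualBasesA) (hT : D.IsMarkovTrace T)
    (hU : ∀ u ∈ D.U, (∀ v ∈ D.U, D.T₀ T (u * v) = 0) → u = 0) {a : D.A}
    (ha : ∀ b, D.trA T (a * b) = 0) : a = 0 := by
  rw [← Z.sum_mulU_mul a]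
  refine Finset.sum_eq_zero fun j _ => ?_
  have : D.expA (a * Z.z j) = 0 := Subtype.ext <| hU _ (D.expA _).2 fun v hv => by
    have := ha (Z.z j * D.mulU ⟨v, hv⟩)
    rwa [← mul_assoc, hT.trA_mul_comm, trA_mulU_mul, hT.E_map_mul_comm] at this
  rw [this, map_zero, zero_mul]

/-- Undoing a transpose with itself requires exchanging the arguments of the form. The form `E(m
m')` need not be symmetric, but `T₀(m m')` is, so the difference is invisible to the non-degenerate
trace. -/
theorem transpose_transpose (hT : D.IsMarkovTrace T)
    (hnd : ∀ a : D.A, (∀ b, D.trA T (a * b) = 0) → a = 0) (a : D.A) :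
    D.transpose (D.transpose a) = a := by
  rw [← sub_eq_zero]
  refine hnd _ fun b => ?_
  rw [sub_mul, map_sub, sub_eq_zero, trA_apply, trA_apply]
  congr 1
  refine Finset.sum_congr rfl fun i _ => ?_
  rw [act_mul_apply, act_mul_apply, LinearMap.comp_apply, E_transpose_mul,
    ← LinearMap.comp_apply, hT.E_map_mul_comm, LinearMap.comp_apply, E_transpose_mul,
    ← LinearMap.comp_apply, hT.E_map_mul_comm]

/-- The element `m ↦ E_M(F(m) z)` of `A`, for an `N`-bimodule map `F : M → M₁`. -/
def slice (F : M →ₗ[k] D.M₁) (hr : ∀ m n, F (m * D.incl n) = F m * D.mulLeftHom (D.incl n))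
    (hl : ∀ n m, F (D.incl n * m) = D.mulLeftHom (D.incl n) * F m) (z : D.A) : D.A :=
  D.mkA (D.condExp ∘ₗ LinearMap.mulRight k (z : D.M₁) ∘ₗ F)
    (fun m n => by
      have h : D.mulLeftHom (D.incl n) * (z : D.M₁) = z * D.mulLeftHom (D.incl n) :=
        Subalgebra.mem_centralizer_iff k |>.1 z.2 _ ⟨n, rfl⟩
      simp only [LinearMap.comp_apply, LinearMap.mulRight_apply, hr, mul_assoc, h]
      rw [← mul_assoc, condExp_mul_mulLeftHom])
    (fun n m => by
      simp only [LinearMap.comp_apply, LinearMap.mulRight_apply, hl, mul_assoc]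
      rw [condExp_mulLeftHom_mul])

theorem act_slice (F : M →ₗ[k] D.M₁) (hr hl) (z : D.A) (m : M) :
    D.act (slice F hr hl z) m = D.condExp (F m * z) := rfl

theorem mulLeftHom_incl_mul (a : D.A) (n : N) :
    D.mulLeftHom (D.incl n) * (a : D.M₁) = a * D.mulLeftHom (D.incl n) :=
  Subalgebra.mem_centralizer_iff k |>.1 a.2 _ ⟨n, rfl⟩

theorem trA_slice_mul (F : M →ₗ[k] D.M₁) (hr hl) (z a : D.A) :
    D.trA T (slice F hr hl z * a) =
      D.lam * D.T₁ T (∑ i, F (D.act a (D.x i)) * z * D.mulLeftHom (D.y i)) := by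
  rw [trA_apply, map_sum]
  simp only [act_mul_apply, act_slice, LinearMap.comp_apply, condExp_mul_mulLeftHom]

/-- The trace of `A` is invariant under transposition. -/
theorem trA_transpose (Z : D.DualBasesA) (hT : D.IsMarkovTrace T) (hs : D.IsSymmetric)
    (hp : D.SymmetricProduct T) [Module.Finite k D.A]
    (hU : ∀ u ∈ D.U, (∀ v ∈ D.U, D.T₀ T (u * v) = 0) → u = 0)
    (hnd : ∀ a : D.A, (∀ b, D.trA T (a * b) = 0) → a = 0) (a : D.A) :
    D.trA T (D.transpose a) = D.trA T a := by
  -- A non-degenerate trace in finite dimension represents every functional; what remains is to show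
  -- `g = 1`.
  obtain ⟨g, hg⟩ : ∃ g : D.A, ∀ a, D.trA T (g * a) = D.trA T (D.transpose a) := by
    let β : D.A →ₗ[k] Module.Dual k D.A := (LinearMap.mul k D.A).compr₂ (D.trA T)
    have hβ : Function.Surjective β := by
      refine (LinearMap.injective_iff_surjective_of_finrank_eq_finrank
        Subspace.dual_finrank_eq.symm).1
        ((injective_iff_map_eq_zero β).2 fun u hu => hnd u fun v => ?_)
      exact LinearMap.congr_fun hu v
    obtain ⟨g, hg⟩ := hβ (D.trA T ∘ₗ D.transpose)
    exact ⟨g, fun a => LinearMap.congr_fun hg a⟩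
  -- After multiplication by `λ`, both sides reduce to `T₀(E_M(â) E_M(g z))`, because transposition
  -- reverses both products.
  have conv_g (a z : D.A) : D.trA T (g * D.conv a z) = D.trA T (D.conv (g * a) (g * z)) := by
    apply mul_left_cancel₀ D.lam_ne_zero
    rw [hg, transpose_conv, trA_conv, trA_conv, ← transpose_mulU, ← transpose_mul, ← hg,
      ← mul_assoc, hT.trA_mul_comm, trA_mulU_mul, hT.trA_mul_comm, mul_assoc, hg, transpose_mul,
      transpose_mulRightU D hs, trA_mulU_mul, hT.E_map_mul_comm]
  have expA_g : D.expA g = 1 := by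
    refine Subtype.ext (sub_eq_zero.1 (hU _ (sub_mem (D.expA g).2 (one_mem _)) fun u hu => ?_))
    have h : D.T₀ T (u * D.expA g) = D.T₀ T u := by
      rw [← trA_mulU_mul D T ⟨u, hu⟩, hT.trA_mul_comm, hg, transpose_mulU, hp.trA_mulRightU hT]
    rw [sub_mul, map_sub, hT.E_map_mul_comm, h, OneMemClass.coe_one, one_mul, sub_self]
  -- `F` measures the failure of multiplicativity: `F(m)(m') = g(m m') - g(m) g(m')`.
  let F : M →ₗ[k] D.M₁ := LinearMap.mulLeft k (g : D.M₁) ∘ₗ D.mulLeftHom.toLinearMap -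
    LinearMap.mulRight k (g : D.M₁) ∘ₗ D.mulLeftHom.toLinearMap ∘ₗ D.act g
  have F_apply (m) : F m = g * D.mulLeftHom m - D.mulLeftHom (D.act g m) * g := rfl
  have hr (m n) : F (m * D.incl n) = F m * D.mulLeftHom (D.incl n) := by
    simp [F_apply, sub_mul, mul_assoc, act_mul_incl, mulLeftHom_incl_mul]
  have hl (n m) : F (D.incl n * m) = D.mulLeftHom (D.incl n) * F m := by
    simp [F_apply, mul_sub, ← mul_assoc, act_incl_mul, mulLeftHom_incl_mul]
  -- The slices of `F` are its coefficients in the dual bases. Traced against `a`, they give the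
  -- difference of the two sides of `conv_g`.
  have hF (z : D.A) : slice F hr hl z = 0 := hnd _ fun a => by
    have h : ∑ i, F (D.act a (D.x i)) * z * D.mulLeftHom (D.y i) =
        ((g * D.conv a z - D.conv (g * a) (g * z) : D.A) : D.M₁) := by
      push_cast
      rw [coe_conv, coe_conv, Finset.mul_sum, ← Finset.sum_sub_distrib]
      refine Finset.sum_congr rfl fun i _ => ?_
      simp [F_apply, sub_mul, mul_assoc]
    rw [trA_slice_mul, h, ← trA_eq_T₁, map_sub, conv_g, sub_self, mul_zero]
  have F_zero (m) : F m = 0 := by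
    rw [← Z.sum_condExp_mul (F m)]
    refine Finset.sum_eq_zero fun j _ => ?_
    rw [← act_slice F hr hl, hF, map_zero, LinearMap.zero_apply, map_zero, zero_mul]
  -- Applying `E_M` to `g m = g(m) g` in `M₁` gives `E_M(g) m = g(m) E_M(g)`, where `E_M(g) = 1`.
  have hg1 : g = 1 := A_ext fun m => by
    have h := congrArg D.condExp (F_zero m)
    rw [F_apply, map_sub, condExp_mul_mulLeftHom, condExp_mulLeftHom_mul, ← coe_expA, expA_g,
      map_zero, sub_eq_zero] at h
    simpa using h.symm
  rw [← hg, hg1, one_mul]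

end StronglySeparableExtension

end TraceOnCentralizer

/-! ### The algebra `B` as `A` with convolution, and the two forms as traces on `A`. -/

noncomputable section SecondCentralizer

namespace StronglySeparableExtension

variable {k N M : Type*} [Field k] [Ring N] [Ring M] [Algebra k N] [Algebra k M]
  {D : StronglySeparableExtension k N M} {T : N →ₗ[k] k}

variable (D) in
/-- The action of `B` on `M₁`, as the `M`-bimodule endomorphisms. -/
def actB : D.B →ₐ[k] Module.End k D.M₁ := D.basicConstruction.toEnd.comp D.B.val

theorem actB_mul_mulLeftHom (b : D.B) (f : D.M₁) (m : M) :
    D.actB b (f * D.mulLeftHom m) = D.actB b f * D.mulLeftHom m :=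
  D.basicConstruction.toEnd_mul_incl _ f m

theorem actB_mulLeftHom_mul (b : D.B) (m : M) (f : D.M₁) :
    D.actB b (D.mulLeftHom m * f) = D.mulLeftHom m * D.actB b f := by
  have h : D.incl₂ (D.mulLeftHom m) * (b : D.M₂) = b * D.incl₂ (D.mulLeftHom m) :=
    Subalgebra.mem_centralizer_iff k |>.1 b.2 _ ⟨m, rfl⟩
  have := congrArg (fun g => D.basicConstruction.toEnd g f) h
  simp only [map_mul, Module.End.mul_apply, mulLeftHom_apply] at this
  exact this.symm

/-- `B ≅ A`, evaluating bimodule endomorphisms of `M₁` at the Jones idempotent. -/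
def evalJones : D.B →ₗ[k] D.A where
  toFun b := ⟨D.actB b D.jones, by
    rw [Subalgebra.mem_centralizer_iff]
    rintro _ ⟨n, rfl⟩
    have h : D.mulLeftHom (D.incl n) * D.jones = D.jones * D.mulLeftHom (D.incl n) :=
      mulLeftHom_incl_mul D.jonesA n
    simp only [AlgHom.comp_apply]
    rw [← actB_mulLeftHom_mul, h, actB_mul_mulLeftHom]⟩
  map_add' b b' := Subtype.ext (by simp)
  map_smul' c b := Subtype.ext (by simp)

theorem coe_evalJones (b : D.B) : (evalJones b : D.M₁) = D.actB b D.jones := rfl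

theorem actB_eq_sum (b : D.B) (f : D.M₁) : D.actB b f =
    ∑ i, D.mulLeftHom (D.toEnd f (D.x i)) * evalJones b * D.mulLeftHom (D.y i) := by
  conv_lhs => rw [← D.sum_mul_jones_mul f, map_sum]
  simp only [actB_mul_mulLeftHom, actB_mulLeftHom_mul, coe_evalJones]

theorem evalJones_injective : Function.Injective (evalJones (D := D)) := fun b b' h => by
  refine Subtype.ext (M₁_ext fun f => ?_)
  change D.actB b f = D.actB b' f
  rw [actB_eq_sum, actB_eq_sum, h]

/-- Since `a` commutes with `N`, the assignment `m e₁ m' ↦ m a m'` is balanced over `N` and defines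
an `M`-bimodule map; `F` is this map in coordinates. -/
theorem evalJones_surjective : Function.Surjective (evalJones (D := D)) := fun a => by
  let F : D.M₁ →ₗ[k] D.M₁ := ∑ i, LinearMap.mulRight k (D.mulLeftHom (D.y i)) ∘ₗ
    LinearMap.mulRight k (a : D.M₁) ∘ₗ D.mulLeftHom.toLinearMap ∘ₗ
      LinearMap.applyₗ (D.x i) ∘ₗ D.toEnd.toLinearMap
  have hF (f) : F f = ∑ i, D.mulLeftHom (D.toEnd f (D.x i)) * a * D.mulLeftHom (D.y i) := by
    simp [F]
  -- Right `M`-linearity is a Casimir identity; it needs the sum to be balanced, hence that `a`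
  -- commutes with `N`.
  have hr (f : D.M₁) (m : M) : F (f * D.mulLeftHom m) = F f * D.mulLeftHom m := by
    have := D.sum_balanced_mul_left ((LinearMap.mul k D.M₁).compl₁₂
      (LinearMap.mulRight k (a : D.M₁) ∘ₗ D.mulLeftHom.toLinearMap ∘ₗ D.toEnd f)
      D.mulLeftHom.toLinearMap) (fun m n m' => by
        have h (g : D.M₁) : D.mulLeftHom (D.incl n) * (a * g) =
            a * (D.mulLeftHom (D.incl n) * g) := by
          rw [← mul_assoc, mulLeftHom_incl_mul, mul_assoc]
        simp [D.toEnd_mul_incl, mul_assoc, h]) m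
    rw [hF, hF, Finset.sum_mul]
    simpa [mul_assoc] using this
  let g : D.M₂ := (⟨F, hr⟩ : D.basicConstruction.endRight)
  have hg (f) : D.basicConstruction.toEnd g f = F f := rfl
  refine ⟨⟨g, ?_⟩, Subtype.ext ?_⟩
  · rw [Subalgebra.mem_centralizer_iff]
    rintro _ ⟨m, rfl⟩
    refine M₁_ext fun f => ?_
    simp [hg, hF, mul_assoc]
  · change F D.jones = a
    simp only [hF, jones_apply, mulLeftHom_incl_mul]
    simp only [mul_assoc, ← map_mul, ← Finset.mul_sum, ← map_sum, D.sum_E_mul_y, map_one, mul_one]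

/-- Writing `b'(e₁) = a'` as `∑ a'(xᵢ) e₁ yᵢ` and applying `b` replaces `e₁` by `b(e₁)`, so the
factors appear in the opposite order. -/
theorem evalJones_mul (b b' : D.B) :
    evalJones (b * b') = D.conv (evalJones b') (evalJones b) := by
  refine Subtype.ext ?_
  rw [coe_conv, coe_evalJones, map_mul, Module.End.mul_apply, actB_eq_sum, ← coe_evalJones]
  rfl

theorem evalJones_one : evalJones (1 : D.B) = D.jonesA := Subtype.ext (by
  rw [coe_evalJones, map_one]; rfl)

/-- `B ≅ A`, with the multiplication of `B` corresponding to the convolution product. -/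
def kappa : D.B →ₗ[k] D.A := D.transpose ∘ₗ evalJones

/-- The order is reversed once by evaluation at `e₁` and once by transposition. -/
theorem kappa_mul (b b' : D.B) : kappa (b * b') = D.conv (kappa b) (kappa b') := by
  simp only [kappa, LinearMap.comp_apply, evalJones_mul, transpose_conv]

theorem kappa_one : kappa (1 : D.B) = D.jonesA := by
  simp only [kappa, LinearMap.comp_apply, evalJones_one, transpose_jonesA]

theorem kappa_bijective (htt : ∀ a, D.transpose (D.transpose a) = a) :
    Function.Bijective (kappa (D := D)) :=
  (Function.Involutive.bijective htt).comp ⟨evalJones_injective, evalJones_surjective⟩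

theorem condExp_jones_mul (m : M) (a : D.A) :
    D.condExp (D.jones * (D.mulLeftHom m * a)) = D.lam • D.act (D.transpose a) m := by
  rw [condExp_apply, act_transpose]
  simp [toEnd_coe_A]

theorem mulLeftHom_mul_mulRightU (m : M) (u : D.U) :
    D.mulLeftHom m * (D.mulRightU u : D.M₁) = D.mulRightU u * D.mulLeftHom m :=
  M₁_ext fun x => by simp [toEnd_coe_A, mul_assoc]

/-- Absorbs an element of `B` into `M₁` behind `e₂`, which brings the pairing down from `M₂` to `A`.
On `f = m e₁ m'` the comparison is `E_M(e₁ m a) = λ â(m)`, the source of the transpose. -/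
theorem e₂_mul_e₁_mul (w : D.U) (b : D.B) :
    D.e₂ * D.e₁ * D.incl₂ (D.mulRightU w) * (b : D.M₂) =
      D.e₂ * D.incl₂ (D.transpose (D.mulRightU w * evalJones b)) := by
  refine M₁_ext fun f => ?_
  have h : D.condExp (D.jones * (D.mulRightU w * D.actB b f)) =
      D.condExp (D.transpose (D.mulRightU w * evalJones b) * f) := by
    rw [actB_eq_sum]
    conv_rhs => rw [← D.sum_mul_jones_mul f]
    simp only [Finset.mul_sum, map_sum]
    refine Finset.sum_congr rfl fun i _ => ?_
    simp only [← mul_assoc]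
    rw [condExp_mul_mulLeftHom, condExp_mul_mulLeftHom, condExp_mul_jones, toEnd_coe_A,
      ← condExp_jones_mul, mul_assoc D.jones, ← mulLeftHom_mul_mulRightU]
    simp only [mul_assoc]
    rfl
  simp only [map_mul, Module.End.mul_apply, mulLeftHom_apply, jones_apply]
  exact congrArg D.mulLeftHom h

/-- With `e₂` on the right, `b` acts on `e₁ E_M(f)` and right linearity pulls out `E_M(f)`; no
transpose appears, in contrast to `e₂_mul_e₁_mul`. -/
theorem mul_e₁_mul_e₂ (b : D.B) :
    (b : D.M₂) * D.e₁ * D.e₂ = D.incl₂ (evalJones b) * D.e₂ := by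
  refine M₁_ext fun f => ?_
  simp only [map_mul, Module.End.mul_apply, mulLeftHom_apply, jones_apply]
  exact actB_mul_mulLeftHom b D.jones _

theorem T₂_mul_e₂_mul (f g : D.M₁) :
    D.T₂ T (D.incl₂ f * D.e₂ * D.incl₂ g) = D.lam * D.T₁ T (f * g) := by
  rw [LinearMap.comp_apply, D.basicConstruction.condExp_mul_jones_mul, map_smul]
  rfl

theorem pairing_apply (hs : D.IsSymmetric) {w : D.V} {w₀ : D.U}
    (hw : (w : D.M₁) = D.mulRightU w₀) (a : D.A) (b : D.B) :
    D.pairing T w a b = D.lam⁻¹ * D.trA T (a * kappa b * D.mulU w₀) := by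
  have h : D.pairing T w a b =
      D.lam⁻¹ ^ 2 * D.T₂ T (D.incl₂ a * D.e₂ * D.e₁ * D.incl₂ w * b) := rfl
  rw [h, mul_assoc _ D.e₂, mul_assoc, mul_assoc, ← mul_assoc _ _ (b : D.M₂), hw, e₂_mul_e₁_mul,
    ← mul_assoc, T₂_mul_e₂_mul, transpose_mul, transpose_mulRightU D hs, trA_eq_T₁,
    sq, mul_assoc D.lam⁻¹, inv_mul_cancel_left₀ D.lam_ne_zero, mul_assoc]
  rfl

theorem pairing'_apply {w : D.V} {w₀ : D.U}
    (hw : (w : D.M₁) = D.mulRightU w₀) (a : D.A) (b : D.B) :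
    D.pairing' T w a b = D.lam⁻¹ * D.trA T (evalJones b * D.mulRightU w₀ * a) := by
  have h : D.pairing' T w a b =
      D.lam⁻¹ ^ 2 * D.T₂ T (b * D.e₁ * D.e₂ * D.incl₂ w * D.incl₂ a) := rfl
  rw [h, mul_e₁_mul_e₂, mul_assoc _ (D.incl₂ w), ← map_mul, T₂_mul_e₂_mul, hw, trA_eq_T₁,
    sq, mul_assoc D.lam⁻¹, inv_mul_cancel_left₀ D.lam_ne_zero, mul_assoc]
  rfl

end StronglySeparableExtension

end SecondCentralizer

/-! ### Coalgebras dual to algebras under a perfect pairing. -/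

noncomputable section Duality

open Coalgebra LinearMap

section PerfectPairing

variable {k A B : Type*} [Field k] [AddCommGroup A] [Module k A] [Ring B] [Algebra k B]
  (p : A →ₗ[k] B →ₗ[k] k)

/-- The pairing of `A ⊗ A` with `B ⊗ B`. -/
def tensorPairing : A ⊗[k] A →ₗ[k] Module.Dual k (B ⊗[k] B) :=
  TensorProduct.dualDistrib k B B ∘ₗ TensorProduct.map p p

/-- The pairing of `(A ⊗ A) ⊗ A` with `(B ⊗ B) ⊗ B`. -/
def tensorPairing₃ : (A ⊗[k] A) ⊗[k] A →ₗ[k] Module.Dual k ((B ⊗[k] B) ⊗[k] B) :=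
  TensorProduct.dualDistrib k (B ⊗[k] B) B ∘ₗ TensorProduct.map (tensorPairing p) p

@[simp] theorem tensorPairing_tmul (a a' : A) (b b' : B) :
    tensorPairing p (a ⊗ₜ[k] a') (b ⊗ₜ[k] b') = p a b * p a' b' := by
  simp [tensorPairing, TensorProduct.dualDistrib_apply]

@[simp] theorem tensorPairing₃_tmul (s : A ⊗[k] A) (a : A) (t : B ⊗[k] B) (b : B) :
    tensorPairing₃ p (s ⊗ₜ[k] a) (t ⊗ₜ[k] b) = tensorPairing p s t * p a b := by
  simp [tensorPairing₃, TensorProduct.dualDistrib_apply]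

variable [Module.Finite k B] {p} (hp : Function.Bijective p)

include hp in
theorem tensorPairing_bijective : Function.Bijective (tensorPairing p) := by
  have h : tensorPairing p = (TensorProduct.congr (LinearEquiv.ofBijective p hp)
      (LinearEquiv.ofBijective p hp) ≪≫ₗ TensorProduct.dualDistribEquiv k B B).toLinearMap :=
    TensorProduct.ext' fun a a' => TensorProduct.ext' fun b b' => by
      simp [TensorProduct.dualDistribEquivOfBasis, TensorProduct.dualDistrib_apply]
  rw [h]
  exact LinearEquiv.bijective _

include hp in
theorem tensorPairing₃_bijective : Function.Bijective (tensorPairing₃ p) := by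
  have h : tensorPairing₃ p = (TensorProduct.congr
      (LinearEquiv.ofBijective _ (tensorPairing_bijective hp))
      (LinearEquiv.ofBijective p hp) ≪≫ₗ
        TensorProduct.dualDistribEquiv k (B ⊗[k] B) B).toLinearMap :=
    TensorProduct.ext' fun a a' => TensorProduct.ext' fun b b' => by
      simp [TensorProduct.dualDistribEquivOfBasis, TensorProduct.dualDistrib_apply]
  rw [h]
  exact LinearEquiv.bijective _

include hp in
theorem tensorPairing_ext {s t : A ⊗[k] A}
    (h : ∀ b b', tensorPairing p s (b ⊗ₜ[k] b') = tensorPairing p t (b ⊗ₜ[k] b')) : s = t :=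
  (tensorPairing_bijective hp).1 (TensorProduct.ext' h)

include hp in
theorem tensorPairing₃_ext {s t : (A ⊗[k] A) ⊗[k] A}
    (h : ∀ a b c, tensorPairing₃ p s ((a ⊗ₜ[k] b) ⊗ₜ[k] c) =
      tensorPairing₃ p t ((a ⊗ₜ[k] b) ⊗ₜ[k] c)) : s = t :=
  (tensorPairing₃_bijective hp).1 (TensorProduct.ext_threefold h)

/-- The comultiplication on `A` dual to the multiplication of `B`. -/
def dualComul : A →ₗ[k] A ⊗[k] A :=
  (LinearEquiv.ofBijective _ (tensorPairing_bijective hp)).symm.toLinearMap ∘ₗ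
    (mul' k B).dualMap ∘ₗ p

theorem tensorPairing_dualComul (a : A) (b b' : B) :
    tensorPairing p (dualComul hp a) (b ⊗ₜ[k] b') = p a (b * b') := by
  have h : tensorPairing p (dualComul hp a) = (mul' k B).dualMap (p a) :=
    LinearEquiv.apply_symm_apply (LinearEquiv.ofBijective _ (tensorPairing_bijective hp)) _
  simp [h]

theorem tensorPairing₃_rTensor (s : A ⊗[k] A) (a b c : B) :
    tensorPairing₃ p ((dualComul hp).rTensor A s) ((a ⊗ₜ[k] b) ⊗ₜ[k] c) =
      tensorPairing p s ((a * b) ⊗ₜ[k] c) := by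
  induction s with
  | zero => simp
  | add x y hx hy => simp only [map_add, LinearMap.add_apply, hx, hy]
  | tmul x y => simp [tensorPairing_dualComul]

omit [Module.Finite k B] in
theorem tensorPairing₃_assoc_symm (x : A) (s : A ⊗[k] A) (a b c : B) :
    tensorPairing₃ p ((TensorProduct.assoc k A A A).symm (x ⊗ₜ[k] s)) ((a ⊗ₜ[k] b) ⊗ₜ[k] c) =
      p x a * tensorPairing p s (b ⊗ₜ[k] c) := by
  induction s with
  | zero => simp
  | add y z hy hz => simp only [TensorProduct.tmul_add, map_add, LinearMap.add_apply, hy, hz,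
      mul_add]
  | tmul y z => simp [mul_assoc]

theorem tensorPairing₃_lTensor (s : A ⊗[k] A) (a b c : B) :
    tensorPairing₃ p ((TensorProduct.assoc k A A A).symm ((dualComul hp).lTensor A s))
      ((a ⊗ₜ[k] b) ⊗ₜ[k] c) = tensorPairing p s (a ⊗ₜ[k] (b * c)) := by
  induction s with
  | zero => simp
  | add x y hx hy => simp only [map_add, LinearMap.add_apply, hx, hy]
  | tmul x y => simp [tensorPairing₃_assoc_symm, tensorPairing_dualComul]

/-- The coalgebra structure on `A` dual to the algebra structure on `B`. -/
abbrev dualCoalgebra : Coalgebra k A where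
  comul := dualComul hp
  counit := p.flip 1
  -- Paired with `B ⊗ B ⊗ B`, coassociativity becomes associativity in `B`.
  coassoc := by
    ext a
    apply (TensorProduct.assoc k A A A).symm.injective
    refine tensorPairing₃_ext hp fun x y z => ?_
    simp [tensorPairing₃_rTensor, tensorPairing₃_lTensor, tensorPairing_dualComul, mul_assoc]
  rTensor_counit_comp_comul := by
    have h (s : A ⊗[k] A) (b : B) : p (TensorProduct.lid k A ((p.flip 1).rTensor A s)) b =
        tensorPairing p s (1 ⊗ₜ[k] b) := by
      induction s with
      | zero => simp
      | add x y hx hy => simp only [map_add, LinearMap.add_apply, hx, hy]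
      | tmul x y => simp
    refine LinearMap.ext fun a =>
      (TensorProduct.lid k A).injective (hp.1 (LinearMap.ext fun b => ?_))
    simp [h, tensorPairing_dualComul]
  lTensor_counit_comp_comul := by
    have h (s : A ⊗[k] A) (b : B) : p (TensorProduct.rid k A ((p.flip 1).lTensor A s)) b =
        tensorPairing p s (b ⊗ₜ[k] 1) := by
      induction s with
      | zero => simp
      | add x y hx hy => simp only [map_add, LinearMap.add_apply, hx, hy]
      | tmul x y => simp [mul_comm]
    refine LinearMap.ext fun a =>
      (TensorProduct.rid k A).injective (hp.1 (LinearMap.ext fun b => ?_))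
    simp [h, tensorPairing_dualComul]

end PerfectPairing

/-! ### Transport of weak Hopf structures along algebra isomorphisms. -/

section Transport

variable {k H K : Type*} [Field k] [Ring H] [Algebra k H] [WeakHopfAlgebra k H]
  [Ring K] [Algebra k K] (e : K ≃ₐ[k] H)

namespace WeakHopfAlgebra

/-- `H ⊗ H ≅ K ⊗ K` for an isomorphism of algebras `K ≅ H`. -/
abbrev congr₂ : H ⊗[k] H ≃ₐ[k] K ⊗[k] K := Algebra.TensorProduct.congr e.symm e.symm

/-- `(H ⊗ H) ⊗ H ≅ (K ⊗ K) ⊗ K` for an isomorphism of algebras `K ≅ H`. -/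
abbrev congr₃ : (H ⊗[k] H) ⊗[k] H ≃ₐ[k] (K ⊗[k] K) ⊗[k] K :=
  Algebra.TensorProduct.congr (congr₂ e) e.symm

/-- The comultiplication of `H`, transported to `K`. -/
def transportComul : K →ₗ[k] K ⊗[k] K :=
  (congr₂ e).toLinearMap ∘ₗ comul ∘ₗ e.toLinearMap

/-- The counit of `H`, transported to `K`. -/
def transportCounit : K →ₗ[k] k := counit ∘ₗ e.toLinearMap

/-- The antipode of `H`, transported to `K`. -/
def transportAntipode : K →ₗ[k] K := e.symm.toLinearMap ∘ₗ antipode ∘ₗ e.toLinearMap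

theorem transportComul_apply (x : K) : transportComul e x = congr₂ e (comul (e x)) := rfl

theorem transportCounit_apply (x : K) : transportCounit e x = counit (R := k) (e x) := rfl

theorem transportAntipode_apply (x : K) :
    transportAntipode e x = e.symm (antipode (k := k) (e x)) := rfl

theorem rTensor_transportComul (s : H ⊗[k] H) :
    (transportComul e).rTensor K (congr₂ e s) = congr₃ e (comul.rTensor H s) := by
  induction s with
  | zero => simp
  | add x y hx hy => simp only [map_add, hx, hy]
  | tmul x y => simp [transportComul_apply]

omit [WeakHopfAlgebra k H] in
theorem congr₃_assoc_symm (x : H) (s : H ⊗[k] H) :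
    congr₃ e ((TensorProduct.assoc k H H H).symm (x ⊗ₜ[k] s)) =
      (TensorProduct.assoc k K K K).symm (e.symm x ⊗ₜ[k] congr₂ e s) := by
  induction s with
  | zero => simp
  | add y z hy hz => simp only [TensorProduct.tmul_add, map_add, hy, hz]
  | tmul y z => simp

theorem lTensor_transportComul (s : H ⊗[k] H) :
    (TensorProduct.assoc k K K K).symm ((transportComul e).lTensor K (congr₂ e s)) =
      congr₃ e ((TensorProduct.assoc k H H H).symm (comul.lTensor H s)) := by
  induction s with
  | zero => simp
  | add x y hx hy => simp only [map_add, hx, hy]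
  | tmul x y =>
    rw [lTensor_tmul, congr₃_assoc_symm, Algebra.TensorProduct.congr_apply,
      Algebra.TensorProduct.map_tmul, lTensor_tmul]
    simp [transportComul_apply]

omit [WeakHopfAlgebra k H] in
theorem map_congr₂ (f g : K →ₗ[k] k) (s : H ⊗[k] H) :
    TensorProduct.map f g (congr₂ e s) =
      TensorProduct.map (f ∘ₗ e.symm.toLinearMap) (g ∘ₗ e.symm.toLinearMap) s := by
  induction s with
  | zero => simp
  | add x y hx hy => simp only [map_add, hx, hy]
  | tmul x y => simp

omit [WeakHopfAlgebra k H] in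
theorem comm_congr₂ (s : H ⊗[k] H) :
    TensorProduct.comm k K K (congr₂ e s) = congr₂ e (TensorProduct.comm k H H s) := by
  induction s with
  | zero => simp
  | add x y hx hy => simp only [map_add, hx, hy]
  | tmul x y => simp

/-- A weak Hopf algebra structure transported along an isomorphism of algebras. -/
abbrev transport : WeakHopfAlgebra k K where
  comul := transportComul e
  counit := transportCounit e
  coassoc := by
    refine LinearMap.ext fun x => (TensorProduct.assoc k K K K).symm.injective ?_
    simp only [LinearMap.comp_apply, LinearEquiv.coe_coe, LinearEquiv.symm_apply_apply]
    rw [transportComul_apply, rTensor_transportComul, lTensor_transportComul]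
    congr 1
    apply (TensorProduct.assoc k H H H).injective
    simp
  rTensor_counit_comp_comul := by
    refine LinearMap.ext fun x => ?_
    have h (s : H ⊗[k] H) : (transportCounit e).rTensor K (congr₂ e s) =
        e.symm.toLinearMap.lTensor k (counit.rTensor H s) := by
      induction s with
      | zero => simp
      | add x y hx hy => simp only [map_add, hx, hy]
      | tmul x y => simp [transportCounit_apply]
    rw [LinearMap.comp_apply, transportComul_apply, h]
    simp
  lTensor_counit_comp_comul := by
    refine LinearMap.ext fun x => ?_
    have h (s : H ⊗[k] H) : (transportCounit e).lTensor K (congr₂ e s) =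
        e.symm.toLinearMap.rTensor k (counit.lTensor H s) := by
      induction s with
      | zero => simp
      | add x y hx hy => simp only [map_add, hx, hy]
      | tmul x y => simp [transportCounit_apply]
    rw [LinearMap.comp_apply, transportComul_apply, h]
    simp
  comul_mul x y := by
    simp only [transportComul_apply, map_mul, WeakHopfAlgebra.comul_mul]
  counit_mul_mul x y z := by
    simp only [transportComul_apply, transportCounit_apply, map_mul, map_congr₂,
      WeakHopfAlgebra.counit_mul_mul]
    congr 2
    congr 1 <;> ext <;> simp [transportCounit_apply]
  counit_mul_mul_swap x y z := by
    simp only [transportComul_apply, transportCounit_apply, map_mul, comm_congr₂, map_congr₂,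
      WeakHopfAlgebra.counit_mul_mul_swap]
    congr 2
    congr 1 <;> ext <;> simp [transportCounit_apply]
  comul_comul_one := by
    have h := congrArg (congr₃ e) (comul_comul_one (k := k) (H := H))
    rw [map_mul, congr₃_assoc_symm, ← rTensor_transportComul] at h
    simpa [transportComul_apply] using h
  comul_comul_one_swap := by
    have h := congrArg (congr₃ e) (comul_comul_one_swap (k := k) (H := H))
    rw [map_mul, congr₃_assoc_symm, ← rTensor_transportComul] at h
    simpa [transportComul_apply] using h
  antipode := transportAntipode e
  mul_antipode x := by
    have h₁ (s : H ⊗[k] H) : mul' k K ((transportAntipode e).lTensor K (congr₂ e s)) =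
        e.symm (mul' k H (antipode.lTensor H s)) := by
      induction s with
      | zero => simp
      | add x y hx hy => simp only [map_add, hx, hy]
      | tmul x y => simp [transportAntipode_apply]
    have h₂ (s : H ⊗[k] H) : TensorProduct.lid k K ((transportCounit e).rTensor K (congr₂ e s)) =
        e.symm (TensorProduct.lid k H (counit.rTensor H s)) := by
      induction s with
      | zero => simp
      | add x y hx hy => simp only [map_add, hx, hy]
      | tmul x y => simp [transportCounit_apply]
    have h₃ : x ⊗ₜ[k] (1 : K) = congr₂ e (e x ⊗ₜ[k] 1) := by simp
    rw [transportComul_apply, h₁, WeakHopfAlgebra.mul_antipode, transportComul_apply, h₃,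
      ← map_mul, h₂, map_one e]
  antipode_mul x := by
    have h₁ (s : H ⊗[k] H) : mul' k K ((transportAntipode e).rTensor K (congr₂ e s)) =
        e.symm (mul' k H (antipode.rTensor H s)) := by
      induction s with
      | zero => simp
      | add x y hx hy => simp only [map_add, hx, hy]
      | tmul x y => simp [transportAntipode_apply]
    have h₂ (s : H ⊗[k] H) : TensorProduct.rid k K ((transportCounit e).lTensor K (congr₂ e s)) =
        e.symm (TensorProduct.rid k H (counit.lTensor H s)) := by
      induction s with
      | zero => simp
      | add x y hx hy => simp only [map_add, hx, hy]
      | tmul x y => simp [transportCounit_apply]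
    have h₃ : (1 : K) ⊗ₜ[k] x = congr₂ e (1 ⊗ₜ[k] e x) := by simp
    rw [transportComul_apply, h₁, WeakHopfAlgebra.antipode_mul, transportComul_apply, h₃,
      ← map_mul, h₂, map_one e]
  antipode_mul_antipode x := by
    have h₁ (s : H ⊗[k] H) : mul' k K ((transportAntipode e).rTensor K (congr₂ e s)) =
        e.symm (mul' k H (antipode.rTensor H s)) := by
      induction s with
      | zero => simp
      | add x y hx hy => simp only [map_add, hx, hy]
      | tmul x y => simp [transportAntipode_apply]
    have h₂ (s : (H ⊗[k] H) ⊗[k] H) : mul' k K (TensorProduct.map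
        (mul' k K ∘ₗ (transportAntipode e).rTensor K) (transportAntipode e) (congr₃ e s)) =
        e.symm (mul' k H (TensorProduct.map (mul' k H ∘ₗ antipode.rTensor H) antipode s)) := by
      induction s with
      | zero => simp
      | add x y hx hy => simp only [map_add, hx, hy]
      | tmul x y =>
        rw [Algebra.TensorProduct.congr_apply, Algebra.TensorProduct.map_tmul,
          TensorProduct.map_tmul, TensorProduct.map_tmul, mul'_apply, mul'_apply, map_mul]
        congr 1
        · exact h₁ x
        · simp [transportAntipode_apply]
    rw [transportComul_apply, rTensor_transportComul, h₂, WeakHopfAlgebra.antipode_mul_antipode,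
      transportAntipode_apply]

end WeakHopfAlgebra

end Transport

end Duality

/-! ### The perfect pairing and the comultiplication of `A`. -/

noncomputable section WeakHopfStructure

open LinearMap

namespace StronglySeparableExtension

variable {k N M : Type*} [Field k] [Ring N] [Ring M] [Algebra k N] [Algebra k M]

section mulU

variable (D : StronglySeparableExtension k N M)

@[simp] theorem mulU_one : D.mulU 1 = 1 := A_ext fun m => by simp

@[simp] theorem mulRightU_one : D.mulRightU 1 = 1 := A_ext fun m => by simp

theorem mulU_mul (u v : D.U) : D.mulU (u * v) = D.mulU u * D.mulU v :=
  A_ext fun m => by simp [mul_assoc]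

theorem mulRightU_mul (u v : D.U) : D.mulRightU (u * v) = D.mulRightU v * D.mulRightU u :=
  A_ext fun m => by simp [mul_assoc]

theorem mulU_mul_mulRightU (u v : D.U) :
    D.mulU u * D.mulRightU v = D.mulRightU v * D.mulU u :=
  A_ext fun m => by simp [mul_assoc]

/-- `a ⊗ a' ↦ a(m) a'(m')`. -/
def mulAct (m m' : M) : D.A ⊗[k] D.A →ₗ[k] M :=
  mul' k M ∘ₗ TensorProduct.map (applyₗ m ∘ₗ D.act.toLinearMap) (applyₗ m' ∘ₗ D.act.toLinearMap)

@[simp] theorem mulAct_tmul (m m' : M) (a a' : D.A) :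
    D.mulAct m m' (a ⊗ₜ[k] a') = D.act a m * D.act a' m' := by
  simp [mulAct]

/-- `X` represents `a`, in the sense that `a(m m') = ∑ X₁(m) X₂(m')`. -/
def Represents (X : D.A ⊗[k] D.A) (a : D.A) : Prop :=
  ∀ m m', D.mulAct m m' X = D.act a (m * m')

variable {D}

theorem mulAct_mul_tmul (m m' : M) (X : D.A ⊗[k] D.A) (a a' : D.A) :
    D.mulAct m m' (X * a ⊗ₜ[k] a') = D.mulAct (D.act a m) (D.act a' m') X := by
  induction X with
  | zero => simp
  | add X Y hX hY => simp only [add_mul, map_add, hX, hY]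
  | tmul x y => simp

/-- `Y` splits `b(m m')` into products, and `X` splits `a` on each of these. -/
theorem Represents.mul {X Y : D.A ⊗[k] D.A} {a b : D.A} (hX : D.Represents X a)
    (hY : D.Represents Y b) : D.Represents (X * Y) (a * b) := fun m m' => by
  rw [act_mul_apply, ← hY]
  clear hY
  induction Y with
  | zero => simp
  | add Y Z hY hZ => simp only [mul_add, map_add, hY, hZ]
  | tmul x y => rw [mulAct_mul_tmul, hX, mulAct_tmul]

/-- Expand `a m` in `M₁` along the dual bases: the coefficient `E_M(a m zⱼ)` is, as a function of
`m`, itself an element of `A`. Evaluating at `m'` gives the splitting. -/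
theorem DualBasesA.exists_represents (Z : D.DualBasesA) (a : D.A) :
    ∃ X, D.Represents X a := by
  let F : M →ₗ[k] D.M₁ := LinearMap.mulLeft k (a : D.M₁) ∘ₗ D.mulLeftHom.toLinearMap
  have F_apply (m) : F m = a * D.mulLeftHom m := rfl
  have hr (m n) : F (m * D.incl n) = F m * D.mulLeftHom (D.incl n) := by
    simp [F_apply, mul_assoc]
  have hl (n m) : F (D.incl n * m) = D.mulLeftHom (D.incl n) * F m := by
    simp [F_apply, ← mul_assoc, mulLeftHom_incl_mul]
  refine ⟨∑ j, slice F hr hl (Z.z j) ⊗ₜ[k] Z.w j, fun m m' => ?_⟩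
  have h := congrArg (fun f => D.toEnd f m') (Z.sum_condExp_mul (F m))
  simp only [F_apply, map_sum, map_mul, LinearMap.sum_apply, Module.End.mul_apply,
    mulLeftHom_apply, toEnd_coe_A] at h
  simpa [act_slice, F_apply] using h

end mulU

/-- A symmetric Markov extension with dual bases of `E_M` in `A`, the data of the separability
element of `U`, and the resulting properties of the trace and the transposition on `A`. -/
structure CentralizerDuality (D : StronglySeparableExtension k N M) (T : N →ₗ[k] k) where
  markov : D.IsMarkovTrace T
  symm : D.IsSymmetric
  dualBases : D.DualBasesA
  casimir : TraceCasimir (D.T₀ T ∘ₗ D.U.val.toLinearMap)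
  finite : Module.Finite k D.A
  eq_zero : ∀ a : D.A, (∀ b, D.trA T (a * b) = 0) → a = 0
  transpose_transpose : ∀ a : D.A, D.transpose (D.transpose a) = a
  trA_transpose : ∀ a : D.A, D.trA T (D.transpose a) = D.trA T a

theorem WeaklyIrreducible.nonempty_centralizerDuality {D : StronglySeparableExtension k N M}
    {T : N →ₗ[k] k} (hirr : D.WeaklyIrreducible T) (hT : D.IsMarkovTrace T)
    (hsymm : D.IsSymmetric) (hprod : D.SymmetricProduct T) (hdepth : D.DepthTwo) :
    Nonempty (CentralizerDuality D T) := by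
  obtain ⟨Z⟩ := hdepth.nonempty_dualBasesA
  obtain ⟨C⟩ := hirr.kanzaki.exists_traceCasimir (D.T₀ T ∘ₗ D.U.val.toLinearMap)
    (fun u v => hT.E_map_mul_comm u v)
    (fun u hu => Subtype.ext (hirr.nondegenerate u u.2 fun v hv => hu ⟨v, hv⟩))
  have := hirr.kanzaki.finite
  have hA := Z.finite
  have hnd := fun a => Z.trA_nondegenerate hT hirr.nondegenerate (a := a)
  exact ⟨⟨hT, hsymm, Z, C, hA, hnd, StronglySeparableExtension.transpose_transpose hT hnd,
    StronglySeparableExtension.trA_transpose Z hT hsymm hprod hirr.nondegenerate hnd⟩⟩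

namespace CentralizerDuality

variable {D : StronglySeparableExtension k N M} {T : N →ₗ[k] k} (S : CentralizerDuality D T)

/-- The inverse of the element `w`. -/
def c : D.U := ∑ j, (D.T₀ T ∘ₗ D.U.val.toLinearMap) (S.casimir.b j) • S.casimir.a j

/-- The element `w` of `U`. -/
abbrev w : D.U := S.casimir.w

theorem c_mul_w : S.c * S.w = 1 := S.casimir.mul_w

theorem w_mul_c : S.w * S.c = 1 := S.casimir.w_mul

theorem coe_c_mul_w : (S.c : M) * S.w = 1 := congrArg Subtype.val S.c_mul_w

theorem coe_w_mul_c : (S.w : M) * S.c = 1 := congrArg Subtype.val S.w_mul_c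

theorem w_comm (u : D.U) : (S.w : M) * u = u * S.w := congrArg Subtype.val (S.casimir.w_comm u)

theorem sum_smul_a (u : D.U) :
    ∑ j, D.T₀ T (S.w * (u * S.casimir.b j)) • S.casimir.a j = u := S.casimir.sum_smul_a u

theorem sum_smul_b (u : D.U) :
    ∑ j, D.T₀ T (S.w * (S.casimir.a j * u)) • S.casimir.b j = u := S.casimir.sum_smul_b u

/-- The element `w` of `V`. -/
def wV : D.V :=
  ⟨D.mulRightU S.w, D.basicConstruction.mem_U.2 fun m => mulLeftHom_mul_mulRightU m _⟩

theorem coe_wV : (S.wV : D.M₁) = D.mulRightU S.w := rfl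

/-- The pairing of `A` and `B`. -/
abbrev pair : D.A →ₗ[k] D.B →ₗ[k] k := D.pairing T S.wV

theorem pair_apply (a : D.A) (b : D.B) :
    S.pair a b = D.lam⁻¹ * D.trA T (D.mulU S.w * (a * kappa b)) := by
  rw [pair, pairing_apply S.symm S.coe_wV, S.markov.trA_mul_comm]

include S in
theorem kappa_bijective : Function.Bijective (kappa (D := D)) :=
  StronglySeparableExtension.kappa_bijective S.transpose_transpose

/-- `B ≅ A`. -/
def kappaEquiv : D.B ≃ₗ[k] D.A := LinearEquiv.ofBijective kappa S.kappa_bijective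

theorem kappa_kappaEquiv_symm (a : D.A) : kappa (S.kappaEquiv.symm a) = a :=
  S.kappaEquiv.apply_symm_apply a

theorem mulU_c_mul (a : D.A) : D.mulU S.c * (D.mulU S.w * a) = a := by
  rw [← mul_assoc, ← mulU_mul, c_mul_w, mulU_one, one_mul]

theorem mulRightU_c_mul (a : D.A) : D.mulRightU S.c * (D.mulRightU S.w * a) = a := by
  rw [← mul_assoc, ← mulRightU_mul, w_mul_c, mulRightU_one, one_mul]

theorem mulRightU_w_mul (a : D.A) : D.mulRightU S.w * (D.mulRightU S.c * a) = a := by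
  rw [← mul_assoc, ← mulRightU_mul, c_mul_w, mulRightU_one, one_mul]

theorem pair_eq_zero {a : D.A} (h : ∀ b, S.pair a b = 0) : a = 0 := by
  have h' : D.mulU S.w * a = 0 := S.eq_zero _ fun b => by
    have := h (S.kappaEquiv.symm b)
    rw [pair_apply, kappa_kappaEquiv_symm, ← mul_assoc] at this
    exact (mul_eq_zero.1 this).resolve_left (inv_ne_zero D.lam_ne_zero)
  rw [← S.mulU_c_mul a, h', mul_zero]

include S in
theorem finite_B : Module.Finite k D.B :=
  have := S.finite
  Module.Finite.equiv S.kappaEquiv.symm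

theorem pair_bijective : Function.Bijective S.pair := by
  have := S.finite
  have := S.finite_B
  have hinj : Function.Injective S.pair := (injective_iff_map_eq_zero _).2 fun a ha =>
    S.pair_eq_zero fun b => by rw [ha, LinearMap.zero_apply]
  refine ⟨hinj, (LinearMap.injective_iff_surjective_of_finrank_eq_finrank ?_).1 hinj⟩
  rw [Subspace.dual_finrank_eq, S.kappaEquiv.finrank_eq]

theorem eq_zero_of_pair {b : D.B} (h : ∀ a, S.pair a b = 0) : b = 0 := by
  refine (Module.forall_dual_apply_eq_zero_iff k b).1 fun φ => ?_
  obtain ⟨a, rfl⟩ := S.pair_bijective.2 φ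
  exact h a

theorem pair_nondegenerate : S.pair.Nondegenerate :=
  ⟨fun _ h => S.pair_eq_zero h, fun _ h => S.eq_zero_of_pair h⟩

theorem pairing'_nondegenerate : (D.pairing' T S.wV).Nondegenerate := by
  have h (a : D.A) (b : D.B) : D.pairing' T S.wV a b =
      D.lam⁻¹ * D.trA T (evalJones b * D.mulRightU S.w * a) := pairing'_apply S.coe_wV a b
  refine ⟨fun a (ha : ∀ b, D.pairing' T S.wV a b = 0) => ?_,
    fun b (hb : ∀ a, D.pairing' T S.wV a b = 0) => ?_⟩
  · have h' : D.mulRightU S.w * a = 0 := S.eq_zero _ fun a' => by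
      obtain ⟨b, hb⟩ := evalJones_surjective a'
      have := ha b
      rw [h, hb, mul_assoc, S.markov.trA_mul_comm] at this
      exact (mul_eq_zero.1 this).resolve_left (inv_ne_zero D.lam_ne_zero)
    rw [← S.mulRightU_c_mul a, h', mul_zero]
  · have h' : evalJones b = 0 := S.eq_zero _ fun a' => by
      have := hb (D.mulRightU S.c * a')
      rw [h, mul_assoc, mulRightU_w_mul] at this
      exact (mul_eq_zero.1 this).resolve_left (inv_ne_zero D.lam_ne_zero)
    exact evalJones_injective (by rw [h', map_zero])

/-- `E_M(a * a')` sees `a'` only through `E_M(a')` in `U`; expanding this element by the reproducing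
formula of the separability element separates the two traces. -/
theorem trA_mulU_w_conv (a a' : D.A) :
    D.lam * D.trA T (D.mulU S.w * D.conv a a') =
      ∑ j, D.trA T (D.mulU S.w * (D.mulRightU (S.casimir.b j) * a)) *
        D.trA T (D.mulU S.w * (D.mulU (S.casimir.a j) * a')) := by
  rw [trA_mulU_mul, ← smul_eq_mul, ← map_smul, ← mul_smul_comm, lam_smul_expA_conv,
    ← trA_mulU_mul, ← S.sum_smul_b (D.expA a')]
  simp only [map_sum, map_smul, Finset.sum_mul, Finset.mul_sum, smul_mul_assoc, mul_smul_comm,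
    smul_eq_mul]
  refine Finset.sum_congr rfl fun j _ => ?_
  rw [trA_mulU_mul _ _ _ (_ * a'), expA_mulU_mul, mul_comm]

/-- The comultiplication of the unit of `A`. -/
def comulOne : D.A ⊗[k] D.A :=
  ∑ j, D.mulRightU (S.casimir.b j) ⊗ₜ[k] D.mulU (S.casimir.a j)

theorem comulOne_mul_tmul (a a' : D.A) : S.comulOne * a ⊗ₜ[k] a' =
    ∑ j, (D.mulRightU (S.casimir.b j) * a) ⊗ₜ[k] (D.mulU (S.casimir.a j) * a') := by
  simp [comulOne, Finset.sum_mul]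

/-- Composing `a` with a convolution distributes it over the factors, `a ∘ (c * c') = ∑ (X₁ c) * (X₂
c')`; the trace of each summand then factors. -/
theorem pair_mul_of_represents {X : D.A ⊗[k] D.A} {a : D.A} (hX : D.Represents X a)
    (b b' : D.B) :
    tensorPairing S.pair (S.comulOne * X) (b ⊗ₜ[k] b') = S.pair a (b * b') := by
  have key : D.trA T (D.mulU S.w * (a * kappa (b * b'))) = D.lam * ∑ j, D.T₀ T
      (S.w * (∑ i, D.mulAct (D.act (kappa b) (D.x i))
        (D.act (kappa b') (D.y i * D.x j)) X) * D.y j) := by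
    rw [trA_apply, kappa_mul]
    simp only [hX _ _, ← map_sum, ← act_conv, act_mul_apply, act_mulU]
  rw [pair_apply, key]
  -- The goal no longer involves `a` and is linear in `X`, so pure tensors suffice even though they
  -- represent nothing individually.
  clear hX key
  induction X with
  | zero => simp
  | add X Y hX hY =>
    simp only [mul_add, map_add, LinearMap.add_apply, hX, hY, Finset.sum_add_distrib, add_mul]
  | tmul a a' =>
    have h : D.lam * ∑ j, D.T₀ T (S.w * (∑ i, D.mulAct (D.act (kappa b) (D.x i))
        (D.act (kappa b') (D.y i * D.x j)) (a ⊗ₜ[k] a')) * D.y j) =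
        D.trA T (D.mulU S.w * D.conv (a * kappa b) (a' * kappa b')) := by
      rw [trA_apply]
      simp only [act_mul_apply, act_mulU, act_conv, mulAct_tmul]
    rw [h, comulOne_mul_tmul]
    apply mul_left_cancel₀ (mul_ne_zero D.lam_ne_zero D.lam_ne_zero)
    rw [mul_assoc D.lam D.lam (D.lam⁻¹ * _), mul_inv_cancel_left₀ D.lam_ne_zero, trA_mulU_w_conv]
    simp only [map_sum, LinearMap.sum_apply, tensorPairing_tmul, pair_apply, Finset.mul_sum]
    refine Finset.sum_congr rfl fun j _ => ?_
    simp only [mul_assoc (D.mulRightU _), mul_assoc (D.mulU (S.casimir.a j))]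
    have := D.lam_ne_zero
    field_simp

/-- The comultiplication of `A`. -/
def comul : D.A →ₗ[k] D.A ⊗[k] D.A :=
  have := S.finite_B
  dualComul S.pair_bijective

theorem tensorPairing_comul (a : D.A) (b b' : D.B) :
    tensorPairing S.pair (S.comul a) (b ⊗ₜ[k] b') = S.pair a (b * b') :=
  have := S.finite_B
  tensorPairing_dualComul S.pair_bijective a b b'

theorem tensorPairing_ext {s t : D.A ⊗[k] D.A}
    (h : ∀ b b', tensorPairing S.pair s (b ⊗ₜ[k] b') = tensorPairing S.pair t (b ⊗ₜ[k] b')) :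
    s = t :=
  have := S.finite_B
  _root_.tensorPairing_ext S.pair_bijective h

theorem comul_eq {X : D.A ⊗[k] D.A} {a : D.A} (hX : D.Represents X a) :
    S.comul a = S.comulOne * X :=
  S.tensorPairing_ext fun b b' => by rw [tensorPairing_comul, S.pair_mul_of_represents hX]

theorem comul_one : S.comul 1 = S.comulOne := by
  rw [S.comul_eq (X := 1) fun m m' => by
    rw [Algebra.TensorProduct.one_def, mulAct_tmul]; simp, mul_one]

theorem comul_mulRightU (u : D.U) :
    S.comul (D.mulRightU u) = S.comulOne * 1 ⊗ₜ[k] D.mulRightU u :=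
  S.comul_eq fun m m' => by simp [mul_assoc]

/-- Multiplying by `Δ(1)` inserts `∑ bⱼ aⱼ = 1` between `X₁(m)` and `X₂(m')`. -/
theorem represents_comulOne_mul {X : D.A ⊗[k] D.A} {a : D.A} (hX : D.Represents X a) :
    D.Represents (S.comulOne * X) a := fun m m' => by
  rw [← hX]
  clear hX
  induction X with
  | zero => simp
  | add X Y hX hY => simp only [mul_add, map_add, hX, hY]
  | tmul x y =>
    rw [comulOne_mul_tmul]
    have h : ∑ j, (S.casimir.b j : M) * S.casimir.a j = 1 := by
      simpa using congrArg Subtype.val S.casimir.isSep.sum_mul_swap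
    have h' (j) : (D.act x m * S.casimir.b j) * (S.casimir.a j * D.act y m') =
        D.act x m * ((S.casimir.b j * S.casimir.a j) * D.act y m') := by simp only [mul_assoc]
    simp only [map_sum, mulAct_tmul, act_mul_apply, act_mulRightU, act_mulU, h',
      ← Finset.mul_sum, ← Finset.sum_mul, h, one_mul]

theorem represents_comul (a : D.A) : D.Represents (S.comul a) a := by
  obtain ⟨X, hX⟩ := S.dualBases.exists_represents a
  rw [S.comul_eq hX]
  exact S.represents_comulOne_mul hX

theorem comulOne_mul_comul (a : D.A) : S.comulOne * S.comul a = S.comul a :=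
  (S.comul_eq (S.represents_comul a)).symm

/-- `Δ(a) Δ(b)` represents `a b`, and it is already fixed by left multiplication by `Δ(1)`. -/
theorem comul_mul (a b : D.A) : S.comul (a * b) = S.comul a * S.comul b := by
  rw [S.comul_eq ((S.represents_comul a).mul (S.represents_comul b)), ← mul_assoc,
    comulOne_mul_comul]

end CentralizerDuality

end StronglySeparableExtension

end WeakHopfStructure

/-! ### Counit, unit and antipode axioms for `A`. -/

noncomputable section WeakHopfAxioms

open LinearMap

section

variable {k R : Type*} [Field k] [Ring R] [Algebra k R]

theorem tmul_one_mul_assoc_symm_sum {ι : Type*} [Fintype ι] (s : R ⊗[k] R) (a b : ι → R) :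
    (s ⊗ₜ[k] (1 : R)) * (TensorProduct.assoc k R R R).symm ((1 : R) ⊗ₜ[k] ∑ j, a j ⊗ₜ[k] b j) =
      ∑ j, (s * 1 ⊗ₜ[k] a j) ⊗ₜ[k] b j := by
  simp [TensorProduct.tmul_sum, Finset.mul_sum]

theorem assoc_symm_sum_mul_tmul_one {ι : Type*} [Fintype ι] (s : R ⊗[k] R) (a b : ι → R) :
    (TensorProduct.assoc k R R R).symm ((1 : R) ⊗ₜ[k] ∑ j, a j ⊗ₜ[k] b j) * (s ⊗ₜ[k] (1 : R)) =
      ∑ j, (1 ⊗ₜ[k] a j * s) ⊗ₜ[k] b j := by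
  simp [TensorProduct.tmul_sum, Finset.sum_mul]

theorem mul'_map_assoc_symm_lTensor (S : R →ₗ[k] R) (δ : R →ₗ[k] R ⊗[k] R) (X : R ⊗[k] R) :
    mul' k R (TensorProduct.map (mul' k R ∘ₗ S.rTensor R) S
      ((TensorProduct.assoc k R R R).symm (δ.lTensor R X))) =
      mul' k R (TensorProduct.map S (mul' k R ∘ₗ S.lTensor R ∘ₗ δ) X) := by
  have h (x : R) (Y : R ⊗[k] R) :
      mul' k R (TensorProduct.map (mul' k R ∘ₗ S.rTensor R) S
        ((TensorProduct.assoc k R R R).symm (x ⊗ₜ[k] Y))) = S x * mul' k R (S.lTensor R Y) := by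
    induction Y with
    | zero => simp
    | add X Y hX hY => simp only [TensorProduct.tmul_add, map_add, mul_add, hX, hY]
    | tmul y z => simp [mul_assoc]
  induction X with
  | zero => simp
  | add X Y hX hY => simp only [map_add, hX, hY]
  | tmul x y => simp [h]

theorem map_mul'_lTensor_of_antimultiplicative (S : R →ₗ[k] R)
    (hS : ∀ a b, S (a * b) = S b * S a) (X : R ⊗[k] R) :
    S (mul' k R (S.lTensor R X)) =
      mul' k R (S.rTensor R (TensorProduct.comm k R R (TensorProduct.map S S X))) := by
  induction X with
  | zero => simp
  | add X Y hX hY => simp only [map_add, hX, hY]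
  | tmul x y => simp [hS]

theorem tensorPairing_comm_map {A B : Type*} [AddCommGroup A] [Module k A] [Ring B] [Algebra k B]
    (p : A →ₗ[k] B →ₗ[k] k) (S : A →ₗ[k] A) (S' : B →ₗ[k] B)
    (h : ∀ a b, p (S a) b = p a (S' b)) (X : A ⊗[k] A) (b b' : B) :
    tensorPairing p (TensorProduct.comm k A A (TensorProduct.map S S X)) (b ⊗ₜ[k] b') =
      tensorPairing p X (S' b' ⊗ₜ[k] S' b) := by
  induction X with
  | zero => simp
  | add X Y hX hY => simp only [map_add, LinearMap.add_apply, hX, hY]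
  | tmul x y => simp [h, mul_comm]

end

namespace StronglySeparableExtension

variable {k N M : Type*} [Field k] [Ring N] [Ring M] [Algebra k N] [Algebra k M]
  {D : StronglySeparableExtension k N M} {T : N →ₗ[k] k}

/-- The action of `A` on `U`. -/
def actU (a : D.A) (u : D.U) : D.U := ⟨D.act a u, D.act_mem_U a u⟩

@[simp] theorem coe_actU (a : D.A) (u : D.U) : (actU a u : M) = D.act a u := rfl

theorem trA_mul_jonesA (a : D.A) : D.trA T (a * D.jonesA) = D.lam * D.T₀ T (D.act a 1) := by
  have h := D.condExp_mul_jones (a : D.M₁) 1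
  rw [map_one, mul_one] at h
  refine (congrArg (D.T₀ T) h).trans ?_
  rw [map_smul]
  rfl

namespace CentralizerDuality

variable (S : CentralizerDuality D T)

/-- The counit of `A`. -/
def counit : D.A →ₗ[k] k := S.pair.flip 1

theorem counit_apply (a : D.A) : S.counit a = D.T₀ T (S.w * D.act a 1) := by
  rw [counit, LinearMap.flip_apply, pair_apply, kappa_one, ← mul_assoc, trA_mul_jonesA,
    inv_mul_cancel_left₀ D.lam_ne_zero, act_mul_apply, act_mulU]

/-- The reproducing formula on `U` merges two values of `T₀(w ·)` into one. When `X` represents `x`,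
the right side becomes the counit of `a x b`. -/
theorem counit_counit_comulOne_mul (a b : D.A) (X : D.A ⊗[k] D.A) :
    mul' k k (TensorProduct.map (S.counit ∘ₗ mulLeft k a) (S.counit ∘ₗ mulRight k b)
      (S.comulOne * X)) = D.T₀ T (S.w * D.act a (D.mulAct 1 (D.act b 1) X)) := by
  induction X with
  | zero => simp
  | add X Y hX hY => simp only [mul_add, map_add, hX, hY]
  | tmul x y =>
    have h := congrArg Subtype.val (S.sum_smul_b (actU (y * b) 1))
    simp only [AddSubmonoidClass.coe_finsetSum, Subalgebra.coe_smul, coe_actU, act_mul_apply,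
      OneMemClass.coe_one] at h
    rw [comulOne_mul_tmul, mulAct_tmul, ← h]
    simp only [map_sum, TensorProduct.map_tmul, mul'_apply, LinearMap.comp_apply, mulLeft_apply,
      mulRight_apply, counit_apply, act_mul_apply, act_mulRightU, act_mulU, Finset.mul_sum,
      mul_smul_comm, map_smul, smul_eq_mul]
    exact Finset.sum_congr rfl fun j _ => mul_comm _ _

theorem counit_counit_comm_comulOne_mul (a b : D.A) (X : D.A ⊗[k] D.A) :
    mul' k k (TensorProduct.map (S.counit ∘ₗ mulLeft k a) (S.counit ∘ₗ mulRight k b)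
      (TensorProduct.comm k D.A D.A (S.comulOne * X))) =
        D.T₀ T (S.w * D.act a (D.mulAct (D.act b 1) 1 X)) := by
  induction X with
  | zero => simp
  | add X Y hX hY => simp only [mul_add, map_add, hX, hY]
  | tmul x y =>
    have h := congrArg Subtype.val (S.sum_smul_a (actU (x * b) 1))
    simp only [AddSubmonoidClass.coe_finsetSum, Subalgebra.coe_smul, coe_actU, act_mul_apply,
      OneMemClass.coe_one] at h
    rw [comulOne_mul_tmul, mulAct_tmul, ← h]
    simp only [map_sum, TensorProduct.comm_tmul, TensorProduct.map_tmul, mul'_apply,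
      LinearMap.comp_apply, mulLeft_apply,
      mulRight_apply, counit_apply, act_mul_apply, act_mulRightU, act_mulU, Finset.mul_sum,
      Finset.sum_mul, smul_mul_assoc, mul_smul_comm, map_smul, smul_eq_mul]
    exact Finset.sum_congr rfl fun j _ => mul_comm _ _

theorem counit_mul_mul (a b c : D.A) : S.counit (a * b * c) =
    mul' k k (TensorProduct.map (S.counit ∘ₗ mulLeft k a) (S.counit ∘ₗ mulRight k c)
      (S.comul b)) := by
  rw [← comulOne_mul_comul, counit_counit_comulOne_mul, S.represents_comul, counit_apply]
  simp

theorem counit_mul_mul_swap (a b c : D.A) : S.counit (a * b * c) =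
    mul' k k (TensorProduct.map (S.counit ∘ₗ mulLeft k a) (S.counit ∘ₗ mulRight k c)
      (TensorProduct.comm k D.A D.A (S.comul b))) := by
  rw [← comulOne_mul_comul, counit_counit_comm_comulOne_mul, S.represents_comul, counit_apply]
  simp

/-- The first legs of `Δ(1)` are right multiplications, and `r(u)` is represented by `1 ⊗ r(u)`. The
version with the factors exchanged also uses that left and right multiplications commute. -/
theorem comul_comul_one : S.comul.rTensor D.A (S.comul 1) =
    (S.comul 1 ⊗ₜ[k] (1 : D.A)) *
      (TensorProduct.assoc k D.A D.A D.A).symm ((1 : D.A) ⊗ₜ[k] S.comul 1) := by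
  have h : S.comul.rTensor D.A S.comulOne =
      ∑ j, S.comul (D.mulRightU (S.casimir.b j)) ⊗ₜ[k] D.mulU (S.casimir.a j) := by
    rw [comulOne, map_sum]; rfl
  rw [comul_one, h]
  nth_rw 2 [comulOne]
  rw [tmul_one_mul_assoc_symm_sum]
  simp only [comul_mulRightU]

theorem comul_comul_one_swap : S.comul.rTensor D.A (S.comul 1) =
    (TensorProduct.assoc k D.A D.A D.A).symm ((1 : D.A) ⊗ₜ[k] S.comul 1) *
      (S.comul 1 ⊗ₜ[k] (1 : D.A)) := by
  have h (u : D.U) : S.comulOne * 1 ⊗ₜ[k] D.mulRightU u =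
      1 ⊗ₜ[k] D.mulRightU u * S.comulOne := by
    simp only [comulOne, Finset.sum_mul, Finset.mul_sum, Algebra.TensorProduct.tmul_mul_tmul,
      mulU_mul_mulRightU, one_mul, mul_one]
  have h' : S.comul.rTensor D.A S.comulOne =
      ∑ j, S.comul (D.mulRightU (S.casimir.b j)) ⊗ₜ[k] D.mulU (S.casimir.a j) := by
    rw [comulOne, map_sum]; rfl
  rw [comul_one, h']
  nth_rw 1 [comulOne]
  rw [assoc_symm_sum_mul_tmul_one]
  simp only [comul_mulRightU, h]

/-- The antipode of `A`. -/
def antipode : D.A →ₗ[k] D.A :=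
  LinearMap.mulLeft k (D.mulRightU S.c) ∘ₗ LinearMap.mulRight k (D.mulRightU S.w) ∘ₗ D.transpose

theorem antipode_apply (a : D.A) :
    S.antipode a = D.mulRightU S.c * (D.transpose a * D.mulRightU S.w) := rfl

theorem act_antipode (a : D.A) (m : M) :
    D.act (S.antipode a) m = D.act (D.transpose a) (m * S.w) * S.c := by
  simp [antipode_apply]

theorem antipode_mul (a b : D.A) : S.antipode (a * b) = S.antipode b * S.antipode a := by
  simp only [antipode_apply, transpose_mul, mul_assoc, mulRightU_w_mul]

theorem antipode_mulU (u : D.U) : S.antipode (D.mulU u) = D.mulRightU u :=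
  A_ext fun m => by
    rw [act_antipode, transpose_mulU, act_mulRightU, act_mulRightU, mul_assoc m, w_comm,
      ← mul_assoc, mul_assoc, coe_w_mul_c, mul_one]

theorem antipode_mulRightU (u : D.U) : S.antipode (D.mulRightU u) = D.mulU u :=
  A_ext fun m => by
    rw [act_antipode, transpose_mulRightU _ S.symm, act_mulU, act_mulU, mul_assoc, mul_assoc,
      coe_w_mul_c, mul_one]

theorem antipode_injective : Function.Injective S.antipode :=
  (injective_iff_map_eq_zero _).2 fun a ha => by
    have h := congrArg (fun x => D.mulRightU S.w * x * D.mulRightU S.c) ha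
    simp only [antipode_apply, mulRightU_w_mul, mul_zero, zero_mul, mul_assoc] at h
    rw [← mulRightU_mul, c_mul_w, mulRightU_one, mul_one] at h
    rw [← S.transpose_transpose a, h, map_zero]

/-- The antipode of `B`. -/
def antipodeB : D.B →ₗ[k] D.B :=
  S.kappaEquiv.symm.toLinearMap ∘ₗ LinearMap.mulLeft k (D.mulU S.c * D.mulRightU S.w) ∘ₗ
    D.transpose ∘ₗ kappa

theorem kappa_antipodeB (b : D.B) : kappa (S.antipodeB b) =
    D.mulU S.c * D.mulRightU S.w * D.transpose (kappa b) :=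
  S.kappa_kappaEquiv_symm _

/-- The invariance of the trace under transposition is used here: transposing one side leaves a
cyclic permutation of the other. -/
theorem pair_antipode (a : D.A) (b : D.B) : S.pair (S.antipode a) b = S.pair a (S.antipodeB b) := by
  rw [pair_apply, pair_apply, kappa_antipodeB, ← S.trA_transpose (_ * (a * _)), antipode_apply]
  congr 1
  simp only [transpose_mul, transpose_mulU, transpose_mulRightU D S.symm, S.transpose_transpose,
    mul_assoc]
  -- Four rotations move the factors `l(w)`, `r(c)`, `â`, `r(w)` past `κ(b)`.
  rw [S.markov.trA_mul_comm]
  simp only [mul_assoc]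
  rw [S.markov.trA_mul_comm]
  simp only [mul_assoc]
  rw [S.markov.trA_mul_comm]
  simp only [mul_assoc]
  rw [S.markov.trA_mul_comm]
  simp only [mul_assoc]

/-- Transposition reverses convolution, and the factors `w` and `c` meeting between the two
convolved maps cancel. -/
theorem antipodeB_mul (b b' : D.B) :
    S.antipodeB (b * b') = S.antipodeB b' * S.antipodeB b := by
  apply S.kappa_bijective.1
  rw [kappa_mul, kappa_antipodeB, kappa_mul, transpose_conv, kappa_antipodeB, kappa_antipodeB]
  refine A_ext fun m => ?_
  have h (x y : M) : x * S.w * (S.c * y) = x * y := by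
    rw [mul_assoc, ← mul_assoc (S.w : M), coe_w_mul_c, one_mul]
  simp only [act_mul_apply, act_conv, act_mulU, act_mulRightU, Finset.mul_sum, Finset.sum_mul,
    ← mul_assoc]
  refine Finset.sum_congr rfl fun i _ => ?_
  rw [mul_assoc _ (S.c : M), h]

/-- The second form uses evaluation at `e₁` without the transpose contained in `kappa`. The antipode
of `B` supplies that transpose, and its factor `r(c)` cancels `r(w)`. -/
theorem pairing_eq_pairing'_antipodeB (a : D.A) (b : D.B) :
    S.pair a b = D.pairing' T S.wV a (S.antipodeB b) := by
  have h : evalJones (S.antipodeB b) = kappa b * (D.mulU S.w * D.mulRightU S.c) := by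
    rw [← S.transpose_transpose (evalJones _)]
    change D.transpose (kappa (S.antipodeB b)) = _
    simp only [kappa_antipodeB, transpose_mul, S.transpose_transpose, transpose_mulU,
      transpose_mulRightU D S.symm]
  rw [pairing'_apply S.coe_wV, pair_apply, h, mul_assoc, mul_assoc, mul_assoc, mulRightU_c_mul,
    ← mul_assoc, S.markov.trA_mul_comm]

/-- Dual, under the pairing, to the antimultiplicativity of the antipode of `B`. -/
theorem comul_antipode (a : D.A) : S.comul (S.antipode a) =
    TensorProduct.comm k D.A D.A (TensorProduct.map S.antipode S.antipode (S.comul a)) := by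
  refine S.tensorPairing_ext fun b b' => ?_
  rw [tensorPairing_comm_map _ _ _ S.pair_antipode, tensorPairing_comul, tensorPairing_comul,
    pair_antipode, antipodeB_mul]

/-- The antipode turns `r(bⱼ)` on the first leg into `l(bⱼ)`, which meets `l(aⱼ)`, and `∑ bⱼ aⱼ =
1`. So `Δ(a)` may be replaced by any element representing `a`. -/
theorem mul_antipode_comulOne_mul (g : D.A →ₗ[k] D.A)
    (hg : ∀ u a, g (D.mulU u * a) = D.mulU u * g a) (X : D.A ⊗[k] D.A) :
    mul' k D.A (TensorProduct.map S.antipode g (S.comulOne * X)) =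
      mul' k D.A (TensorProduct.map S.antipode g X) := by
  induction X with
  | zero => simp
  | add X Y hX hY => simp only [mul_add, map_add, hX, hY]
  | tmul x y =>
    have h (j) : S.antipode x * D.mulU (S.casimir.b j) * (D.mulU (S.casimir.a j) * g y) =
        S.antipode x * (D.mulU (S.casimir.b j * S.casimir.a j) * g y) := by
      rw [mulU_mul]; simp only [mul_assoc]
    rw [comulOne_mul_tmul]
    simp only [map_sum, TensorProduct.map_tmul, mul'_apply, antipode_mul, antipode_mulRightU, hg, h,
      ← Finset.mul_sum, ← Finset.sum_mul]
    rw [← map_sum, S.casimir.isSep.sum_mul_swap, mulU_one, one_mul]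

/-- This adjunction for `E(m m' w)` explains the factors `w` and `c` in the antipode. -/
theorem E_mul_act_antipode_mul (a : D.A) (m m' : M) :
    D.E (m * (D.act (S.antipode a) m' * S.w)) = D.E (D.act a m * (m' * S.w)) := by
  rw [act_antipode, mul_assoc, coe_c_mul_w, mul_one, ← E_transpose_mul, S.transpose_transpose]

/-- By adjunction, `S(X₁) X₂` tested in `E(m · w)` gives `E(X₁(m) X₂(m') w) = E(a(m m') w)`.
Symmetry and transposition rewrite this as `E(m m' â(w))`, so the element is a right multiplication.
-/
theorem mul_antipode_rTensor (a : D.A) :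
    mul' k D.A (S.antipode.rTensor D.A (S.comul a)) =
      D.mulRightU (S.c * actU (D.transpose a) S.w) := by
  obtain ⟨X, hX⟩ := S.dualBases.exists_represents a
  have h (m m' : M) : D.E (m * (D.act (mul' k D.A (S.antipode.rTensor D.A X)) m' * S.w)) =
      D.E (D.mulAct m m' X * S.w) := by
    clear hX
    induction X with
    | zero => simp
    | add X Y hX hY => simp only [map_add, LinearMap.add_apply, mul_add, add_mul, hX, hY]
    | tmul x y => simp [E_mul_act_antipode_mul, mul_assoc]
  have h' (m : M) : D.act (mul' k D.A (S.antipode.rTensor D.A X)) m * S.w =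
      m * D.act (D.transpose a) S.w := by
    refine D.E_ext_left fun y => ?_
    rw [h, hX, ← S.symm _ S.w.2, ← E_transpose_mul, ← coe_actU, S.symm _ (actU _ _).2, mul_assoc]
  rw [S.comul_eq hX, LinearMap.rTensor, S.mul_antipode_comulOne_mul _ fun u a => rfl]
  refine A_ext fun m => ?_
  have h₂ := congrArg (· * (S.c : M)) (h' m)
  simp only [mul_assoc, coe_w_mul_c, mul_one] at h₂
  have h₃ : S.c * actU (D.transpose a) S.w = actU (D.transpose a) S.w * S.c := by
    rw [← mul_one (S.c * _), ← S.w_mul_c, ← mul_assoc, mul_assoc S.c, ← S.casimir.w_comm,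
      ← mul_assoc, c_mul_w, one_mul]
  rw [h₃]
  exact h₂

theorem antipode_mul_eq (a : D.A) : mul' k D.A (S.antipode.rTensor D.A (S.comul a)) =
    TensorProduct.rid k D.A (S.counit.lTensor D.A (((1 : D.A) ⊗ₜ[k] a) * S.comul 1)) := by
  rw [mul_antipode_rTensor, comul_one, comulOne, Finset.mul_sum,
    ← S.sum_smul_b (S.c * actU (D.transpose a) S.w)]
  simp only [map_sum, map_smul, Algebra.TensorProduct.tmul_mul_tmul, lTensor_tmul,
    TensorProduct.rid_tmul, one_mul]
  refine Finset.sum_congr rfl fun j _ => ?_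
  congr 1
  rw [counit_apply, act_mul_apply, act_mulU, mul_one, LinearMap.comp_apply T D.E (S.w * D.act a _),
    ← E_transpose_mul, ← LinearMap.comp_apply, Subalgebra.coe_mul, coe_actU, ← mul_assoc,
    w_comm, mul_assoc, ← mul_assoc (S.w : M), coe_w_mul_c, one_mul, S.markov.E_map_mul_comm]

/-- Apply the injective antipode: as it reverses products and coproducts, the claim becomes the
formula of `mul_antipode_rTensor` at `S(a)`. -/
theorem mul_antipode_eq (a : D.A) : mul' k D.A (S.antipode.lTensor D.A (S.comul a)) =
    D.mulU (actU a 1) := by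
  apply S.antipode_injective
  rw [map_mul'_lTensor_of_antimultiplicative _ S.antipode_mul, ← comul_antipode,
    mul_antipode_rTensor, antipode_mulU]
  congr 1
  refine Subtype.ext ?_
  simp only [antipode_apply, transpose_mul, S.transpose_transpose, transpose_mulRightU D S.symm,
    Subalgebra.coe_mul, coe_actU, act_mul_apply, act_mulU, coe_c_mul_w, ← mul_assoc, one_mul,
    OneMemClass.coe_one]

theorem mul_antipode (a : D.A) : mul' k D.A (S.antipode.lTensor D.A (S.comul a)) =
    TensorProduct.lid k D.A (S.counit.rTensor D.A (S.comul 1 * (a ⊗ₜ[k] (1 : D.A)))) := by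
  rw [mul_antipode_eq, comul_one, comulOne_mul_tmul, ← S.sum_smul_a (actU a 1)]
  simp only [map_sum, map_smul, rTensor_tmul, TensorProduct.lid_tmul, mul_one, counit_apply,
    act_mul_apply, act_mulRightU, coe_actU, OneMemClass.coe_one]

/-- The coalgebra structure of `A`. -/
abbrev coalgebra : Coalgebra k D.A :=
  have := S.finite_B
  dualCoalgebra S.pair_bijective

theorem antipode_mul_antipode (a : D.A) :
    mul' k D.A (TensorProduct.map (mul' k D.A ∘ₗ S.antipode.rTensor D.A) S.antipode
      (S.comul.rTensor D.A (S.comul a))) = S.antipode a := by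
  have coassoc : S.comul.rTensor D.A (S.comul a) =
      (TensorProduct.assoc k D.A D.A D.A).symm (S.comul.lTensor D.A (S.comul a)) := by
    rw [LinearEquiv.eq_symm_apply]
    exact LinearMap.congr_fun S.coalgebra.coassoc a
  -- By coassociativity the last two legs may be combined first, which leaves the left
  -- multiplication `g(x) = l(x(1))`.
  let g : D.A →ₗ[k] D.A := mul' k D.A ∘ₗ S.antipode.lTensor D.A ∘ₗ S.comul
  have hg (x : D.A) : g x = D.mulU (actU x 1) := S.mul_antipode_eq x
  have h₂ := mul'_map_assoc_symm_lTensor S.antipode S.comul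
  -- For `X` representing `a`, the right side is `E(a(m) m' w)`, which by adjunction characterizes
  -- `S(a)`.
  have h₃ (m m' : M) (X : D.A ⊗[k] D.A) :
      D.E (m * (D.act (mul' k D.A (TensorProduct.map S.antipode g X)) m' * S.w)) =
      D.E (D.mulAct m 1 X * (m' * S.w)) := by
    induction X with
    | zero => simp
    | add X Y hX hY => simp only [map_add, LinearMap.add_apply, mul_add, add_mul, hX, hY]
    | tmul x y => simp [hg, E_mul_act_antipode_mul, mul_assoc]
  obtain ⟨X, hX⟩ := S.dualBases.exists_represents a
  rw [coassoc, h₂, S.comul_eq hX]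
  change mul' k D.A (TensorProduct.map S.antipode g _) = _
  rw [S.mul_antipode_comulOne_mul g fun u a => by
    rw [hg, hg, ← mulU_mul]; rfl]
  refine A_ext fun m => ?_
  have h₄ : D.act (mul' k D.A (TensorProduct.map S.antipode g X)) m * S.w =
      D.act (S.antipode a) m * S.w := D.E_ext_left fun y => by
    rw [h₃, hX, mul_one, E_mul_act_antipode_mul]
  simpa [mul_assoc, coe_w_mul_c] using congrArg (· * (S.c : M)) h₄

/-- The weak Hopf algebra structure of `A`. -/
abbrev weakHopfAlgebra : WeakHopfAlgebra k D.A where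
  toCoalgebra := S.coalgebra
  comul_mul := S.comul_mul
  counit_mul_mul := S.counit_mul_mul
  counit_mul_mul_swap := S.counit_mul_mul_swap
  comul_comul_one := S.comul_comul_one
  comul_comul_one_swap := S.comul_comul_one_swap
  antipode := S.antipode
  mul_antipode := S.mul_antipode
  antipode_mul := S.antipode_mul_eq
  antipode_mul_antipode := S.antipode_mul_antipode

end CentralizerDuality

end StronglySeparableExtension

end WeakHopfAxioms

/-! ### Separability and semisimplicity of `A`. -/

noncomputable section Semisimplicity

section

variable {k R : Type*} [Field k] [Ring R] [Algebra k R]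

/-- A separable algebra over a field is semisimple. -/
theorem isSemisimpleRing_of_separable {ι : Type*} [Fintype ι] (a b : ι → R)
    (h₁ : ∑ j, a j * b j = 1)
    (h₂ : ∀ r, ∑ j, (r * a j) ⊗ₜ[k] b j = ∑ j, a j ⊗ₜ[k] (b j * r)) : IsSemisimpleRing R := by
  refine (isSemisimpleModule_iff R R).2 ⟨fun I => ?_⟩
  obtain ⟨p, hp⟩ := (I.restrictScalars k).subtype.exists_leftInverse_of_injective (by simp)
  have hp' (x : R) (hx : x ∈ I) : (p x : R) = x := congrArg Subtype.val
    (LinearMap.congr_fun hp ⟨x, hx⟩)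
  have hmem (x : R) : ∑ j, a j * (p (b j * x) : R) ∈ I :=
    Submodule.sum_mem _ fun j _ => I.smul_mem (a j) (p (b j * x)).2
  -- Averaging the `k`-linear projection over the separability element makes it `R`-linear, as in
  -- Maschke's theorem.
  let q : R →ₗ[R] I :=
    { toFun := fun x => ⟨∑ j, a j * (p (b j * x) : R), hmem x⟩
      map_add' := fun x y => Subtype.ext (by simp [mul_add, Finset.sum_add_distrib])
      map_smul' := fun r x => Subtype.ext (by
        have := congrArg (LinearMap.mul' k R ∘ₗ ((I.restrictScalars k).subtype ∘ₗ p ∘ₗ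
          LinearMap.mulRight k x).lTensor R) (h₂ r)
        simpa [Finset.mul_sum, mul_assoc] using this.symm) }
  refine ⟨LinearMap.ker q, LinearMap.isCompl_of_proj fun x => Subtype.ext ?_⟩
  change ∑ j, a j * (p (b j * x) : R) = x
  have h (j : ι) : a j * (p (b j * x) : R) = a j * b j * x := by
    rw [hp' (b j * x) (I.smul_mem (b j) x.2), mul_assoc]
  simp only [h, ← Finset.sum_mul, h₁, one_mul]

end

namespace StronglySeparableExtension

variable {k N M : Type*} [Field k] [Ring N] [Ring M] [Algebra k N] [Algebra k M]
  {D : StronglySeparableExtension k N M}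

/-- The sum `∑ zⱼ wⱼ` does not depend on the dual bases; for the standard ones of `M ↪ M₁` it is
`λ⁻¹`. -/
theorem DualBasesA.sum_mul (Z : D.DualBasesA) : D.lam • ∑ j, Z.z j * Z.w j = 1 := by
  refine Subtype.ext ?_
  let D' := D.basicConstruction
  have h : ∑ j, (Z.z j : D.M₁) * Z.w j = ∑ i, D'.x i * D'.y i := by
    have hw (j) : (Z.w j : D.M₁) =
        ∑ i, D.mulLeftHom (D.condExp (Z.w j * D'.x i)) * D'.y i := (D'.sum_E_mul _).symm
    calc ∑ j, (Z.z j : D.M₁) * Z.w j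
        = ∑ j, ∑ i, Z.z j * D.mulLeftHom (D.condExp (Z.w j * D'.x i)) * D'.y i := by
          refine Finset.sum_congr rfl fun j _ => ?_
          conv_lhs => rw [hw, Finset.mul_sum]
          simp only [mul_assoc]
      _ = _ := by
          rw [Finset.sum_comm]
          simp only [← Finset.sum_mul, Z.sum_mul_condExp]
  have h' : ∑ i, D'.x i * D'.y i = algebraMap k D.M₁ D.lam⁻¹ := D'.sum_x_mul_y
  rw [Subalgebra.coe_smul]
  simp only [AddSubmonoidClass.coe_finsetSum, Subalgebra.coe_mul, h, h',
    Algebra.algebraMap_eq_smul_one, smul_smul, mul_inv_cancel₀ D.lam_ne_zero, one_smul,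
    OneMemClass.coe_one]

/-- `λ ∑ zⱼ ⊗ wⱼ` is a separability element of `A` over `U`. Placing that of `U` over `k` in the
middle gives `λ ∑ zⱼ aᵢ ⊗ bᵢ wⱼ`, a separability element over `k`. -/
theorem DualBasesA.isSemisimpleRing (Z : D.DualBasesA) (hU : IsKanzakiSeparable k D.U) :
    IsSemisimpleRing D.A := by
  obtain ⟨f, hf⟩ := hU
  obtain ⟨n, a, b, rfl⟩ := TensorProduct.exists_sum_tmul_eq f
  -- The inserted separability element lets `U` pass from one side to the other, as in a tensor
  -- product over `U`.
  have hG (x y : D.A) (u : D.U) :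
      ∑ i, (x * D.mulU u * D.mulU (a i)) ⊗ₜ[k] (D.mulU (b i) * y) =
        ∑ i, (x * D.mulU (a i)) ⊗ₜ[k] (D.mulU (b i) * (D.mulU u * y)) := by
    have := congrArg (TensorProduct.map (LinearMap.mulLeft k x ∘ₗ D.mulU)
      (LinearMap.mulRight k y ∘ₗ D.mulU)) (hf.sum_mul_tmul u)
    simpa [mulU_mul, mul_assoc] using this
  refine isSemisimpleRing_of_separable (k := k)
    (fun p : Fin Z.size × Fin n => D.lam • (Z.z p.1 * D.mulU (a p.2)))
    (fun p => D.mulU (b p.2) * Z.w p.1) ?_ fun r => ?_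
  · rw [Fintype.sum_prod_type]
    have h (j) (i) : D.lam • (Z.z j * D.mulU (a i)) * (D.mulU (b i) * Z.w j) =
        D.lam • (Z.z j * (D.mulU (a i * b i) * Z.w j)) := by
      rw [mulU_mul, smul_mul_assoc]; simp only [mul_assoc]
    simp only [h, ← Finset.smul_sum, ← Finset.mul_sum, ← Finset.sum_mul]
    rw [← map_sum, hf.sum_mul, mulU_one]
    simp only [one_mul, Z.sum_mul]
  · rw [Fintype.sum_prod_type, Fintype.sum_prod_type]
    simp only [mul_smul_comm, ← TensorProduct.smul_tmul',
      ← Finset.smul_sum]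
    congr 1
    -- Expand `r zⱼ` along the `zₗ`, move the coefficients `E_M(wₗ r zⱼ)` across by `hG`, and
    -- recombine the sum over `j` to `wₗ r`.
    calc ∑ j, ∑ i, (r * (Z.z j * D.mulU (a i))) ⊗ₜ[k] (D.mulU (b i) * Z.w j)
        = ∑ j, ∑ l, ∑ i, (Z.z l * D.mulU (D.expA (Z.w l * (r * Z.z j))) * D.mulU (a i)) ⊗ₜ[k]
            (D.mulU (b i) * Z.w j) := by
          refine Finset.sum_congr rfl fun j _ => ?_
          rw [Finset.sum_comm]
          refine Finset.sum_congr rfl fun i _ => ?_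
          rw [← TensorProduct.sum_tmul, ← Finset.sum_mul, Z.sum_mul_mulU, mul_assoc]
      _ = ∑ l, ∑ i, (Z.z l * D.mulU (a i)) ⊗ₜ[k] (D.mulU (b i) * Z.w l * r) := by
          simp only [hG]
          rw [Finset.sum_comm]
          refine Finset.sum_congr rfl fun l _ => ?_
          rw [Finset.sum_comm]
          refine Finset.sum_congr rfl fun i _ => ?_
          rw [← TensorProduct.tmul_sum, ← Finset.mul_sum]
          simp only [← mul_assoc (Z.w l), Z.sum_mulU_mul]
          rw [mul_assoc]

end StronglySeparableExtension

end Semisimplicity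

/-! ### The dual structure on `B` and the separability element of `V`. -/

noncomputable section DualWeakHopf

open LinearMap

section

variable {k A B : Type*} [Field k] [Ring A] [Algebra k A] [Ring B] [Algebra k B]
  [Module.Finite k A] [Module.Finite k B] [WeakHopfAlgebra k A]
  (p : A →ₗ[k] B →ₗ[k] k) (hp : Function.Bijective p)
  (h_comul : ∀ (a : A) (b b' : B),
    tensorPairing p (Coalgebra.comul (R := k) a) (b ⊗ₜ[k] b') = p a (b * b'))
  (h_counit : ∀ a : A, Coalgebra.counit (R := k) a = p a 1)

omit [Module.Finite k A] [Module.Finite k B] [WeakHopfAlgebra k A] in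
theorem mul'_map_flip (t : A ⊗[k] A) (b b' : B) :
    mul' k k (TensorProduct.map (p.flip b) (p.flip b') t) =
      tensorPairing p t (b ⊗ₜ[k] b') := by
  induction t with
  | zero => simp
  | add x y hx hy => simp only [map_add, LinearMap.add_apply, hx, hy]
  | tmul x y => simp

omit [Module.Finite k A] [Module.Finite k B] [WeakHopfAlgebra k A] in
theorem mul'_map_eq_tensorPairing (t : B ⊗[k] B) (a a' : A) :
    mul' k k (TensorProduct.map (p a) (p a') t) = tensorPairing p (a ⊗ₜ[k] a') t := by
  induction t with
  | zero => simp
  | add x y hx hy => simp only [map_add, hx, hy]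
  | tmul x y => simp

/-- An algebra in perfect duality with a weak Hopf algebra `A` is isomorphic to `A*`. -/
def dualAlgEquiv : B ≃ₐ[k] WeakHopfDual k A :=
  AlgEquiv.ofBijective
    (AlgHom.ofLinearMap (WeakHopfDual.toDual.symm.toLinearMap ∘ₗ p.flip)
      (WeakHopfDual.ext fun a => by
        rw [WeakHopfDual.toDual_one_apply, h_counit]; rfl)
      (fun b b' => WeakHopfDual.ext fun a => by
        rw [WeakHopfDual.toDual_mul_apply]
        exact (h_comul a b b').symm.trans (mul'_map_flip p _ b b').symm))
    (WeakHopfDual.toDual.symm.bijective.comp (by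
      have hinj : Function.Injective p.flip := (injective_iff_map_eq_zero _).2 fun b hb => by
        refine (Module.forall_dual_apply_eq_zero_iff k b).1 fun φ => ?_
        obtain ⟨a, rfl⟩ := hp.2 φ
        exact LinearMap.congr_fun hb a
      refine ⟨hinj, (LinearMap.injective_iff_surjective_of_finrank_eq_finrank ?_).1 hinj⟩
      rw [Subspace.dual_finrank_eq, (LinearEquiv.ofBijective p hp).finrank_eq,
        Subspace.dual_finrank_eq]))

theorem toDual_dualAlgEquiv (b : B) (a : A) :
    WeakHopfDual.toDual (dualAlgEquiv p hp h_comul h_counit b) a = p a b := rfl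

theorem apply_dualAlgEquiv_symm (a : A) (φ : WeakHopfDual k A) :
    p a ((dualAlgEquiv p hp h_comul h_counit).symm φ) = WeakHopfDual.toDual φ a := by
  rw [← toDual_dualAlgEquiv p hp h_comul h_counit, AlgEquiv.apply_symm_apply]

theorem tensorPairing_congr₂ (a a' : A) (t : WeakHopfDual k A ⊗[k] WeakHopfDual k A) :
    tensorPairing p (a ⊗ₜ[k] a')
      (WeakHopfAlgebra.congr₂ (dualAlgEquiv p hp h_comul h_counit) t) =
      WeakHopfDual.ev₂ t (a ⊗ₜ[k] a') := by
  induction t with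
  | zero => simp
  | add x y hx hy => simp only [map_add, LinearMap.add_apply, hx, hy]
  | tmul φ ψ =>
    rw [Algebra.TensorProduct.congr_apply, Algebra.TensorProduct.map_tmul, tensorPairing_tmul,
      WeakHopfDual.ev₂_tmul, TensorProduct.map_tmul, mul'_apply]
    exact congrArg₂ _ (apply_dualAlgEquiv_symm p hp h_comul h_counit a φ)
      (apply_dualAlgEquiv_symm p hp h_comul h_counit a' ψ)

/-- The weak Hopf algebra structure on `B` dual to that of `A`. -/
abbrev dualWeakHopfAlgebra : WeakHopfAlgebra k B :=
  WeakHopfAlgebra.transport (dualAlgEquiv p hp h_comul h_counit)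

theorem tensorPairing_comul_dual (a a' : A) (b : B) :
    letI := dualWeakHopfAlgebra p hp h_comul h_counit
    tensorPairing p (a ⊗ₜ[k] a') (Coalgebra.comul (R := k) b) = p (a * a') b :=
  (tensorPairing_congr₂ p hp h_comul h_counit a a' _).trans (by
    rw [LinearMap.comp_apply, WeakHopfDual.ev₂_comul]; rfl)

theorem apply_antipode_dual (a : A) (b : B) :
    letI := dualWeakHopfAlgebra p hp h_comul h_counit
    p (WeakHopfAlgebra.antipode (k := k) a) b = p a (WeakHopfAlgebra.antipode (k := k) b) :=
  (apply_dualAlgEquiv_symm p hp h_comul h_counit a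
    (WeakHopfDual.antipode (dualAlgEquiv p hp h_comul h_counit b))).symm

/-- A weak Hopf algebra is isomorphic to the dual of a weak Hopf algebra which is in duality
with it. -/
def weakHopfEquivDual :
    letI := dualWeakHopfAlgebra p hp h_comul h_counit
    WeakHopfEquiv k A (WeakHopfDual k B) :=
  letI := dualWeakHopfAlgebra p hp h_comul h_counit
  { AlgEquiv.ofBijective
      (AlgHom.ofLinearMap (WeakHopfDual.toDual.symm.toLinearMap ∘ₗ p)
        (WeakHopfDual.ext fun b => rfl)
        (fun a a' => WeakHopfDual.ext fun b => by
          rw [WeakHopfDual.toDual_mul_apply]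
          exact (tensorPairing_comul_dual p hp h_comul h_counit a a' b).symm.trans
            (mul'_map_eq_tensorPairing p _ a a').symm))
      (WeakHopfDual.toDual.symm.bijective.comp hp) with
    map_comul := fun a => WeakHopfDual.ev₂_ext fun b b' => by
      rw [WeakHopfDual.ev₂_comul, mul'_apply]
      refine (h_comul a b b').symm.trans ?_
      induction Coalgebra.comul (R := k) a with
      | zero => simp
      | add x y hx hy => simp only [map_add, LinearMap.add_apply, hx, hy]
      | tmul x y => rw [TensorProduct.map_tmul, WeakHopfDual.ev₂_tmul]; simp; rfl
    map_counit := fun a => (h_counit a).symm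
    map_antipode := fun a => WeakHopfDual.ext fun b =>
      (apply_antipode_dual p hp h_comul h_counit a b).symm }

end

namespace StronglySeparableExtension

variable {k N M : Type*} [Field k] [Ring N] [Ring M] [Algebra k N] [Algebra k M]
  {D : StronglySeparableExtension k N M} {T : N →ₗ[k] k}

variable (D) in
/-- The anti-isomorphism `U → V`, mapping `u` to the right multiplication by `u`. -/
def mulRightV : D.U →ₗ[k] D.V where
  toFun u := ⟨D.mulRightU u, D.basicConstruction.mem_U.2 fun m => mulLeftHom_mul_mulRightU m _⟩
  map_add' u v := Subtype.ext (by simp)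
  map_smul' c u := Subtype.ext (by simp)

theorem coe_mulRightV (u : D.U) : (D.mulRightV u : D.M₁) = D.mulRightU u := rfl

theorem mulRightV_mul (u v : D.U) : D.mulRightV (u * v) = D.mulRightV v * D.mulRightV u :=
  Subtype.ext (congrArg D.A.val (D.mulRightU_mul u v))

theorem mulRightV_one : D.mulRightV 1 = 1 :=
  Subtype.ext ((coe_mulRightV 1).trans (by rw [mulRightU_one]; rfl))

/-- Commuting with `M` means left `M`-linearity, so `v` is right multiplication by `v(1)`. -/
theorem mulRightV_surjective : Function.Surjective D.mulRightV := fun v => by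
  have hv (m m' : M) : D.toEnd (v : D.M₁) (m * m') = m * D.toEnd (v : D.M₁) m' := by
    have h : D.mulLeftHom m * (v : D.M₁) = v * D.mulLeftHom m := D.basicConstruction.mem_U.1 v.2 m
    simpa using (congrArg (fun f => D.toEnd f m') h).symm
  refine ⟨⟨D.toEnd (v : D.M₁) 1, D.mem_U.2 fun n => ?_⟩, Subtype.ext (M₁_ext fun m => ?_)⟩
  · rw [← hv, ← D.toEnd_mul_incl, mul_one, one_mul]
  · rw [coe_mulRightV, toEnd_coe_A, act_mulRightU, ← hv, mul_one]

namespace CentralizerDuality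

variable (S : CentralizerDuality D T)

/-- The symmetric separability element of `V`. -/
def sepV : D.V ⊗[k] D.V :=
  ∑ j, D.mulRightV (S.casimir.a j) ⊗ₜ[k] D.mulRightV (S.casimir.b j)

/-- `U → V` reverses products, so the conditions on `V` are the inner and swapped forms of those on
`U`, available by flip invariance. -/
theorem isSymmetricSeparabilityElement_sepV : IsSymmetricSeparabilityElement k S.sepV := by
  refine (isSymmetricSeparabilityElement_sum_iff _ _).2 ⟨?_, fun v => ?_, ?_⟩
  · simp only [← mulRightV_mul, ← map_sum, S.casimir.isSep.sum_mul_swap, mulRightV_one]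
  · obtain ⟨u, rfl⟩ := mulRightV_surjective v
    simpa [mulRightV_mul] using congrArg (TensorProduct.map D.mulRightV D.mulRightV)
      (S.casimir.isSep.sum_tmul_mul u)
  · simpa using congrArg (TensorProduct.map D.mulRightV D.mulRightV) S.casimir.isSep.sum_swap

/-- The symmetric product hypothesis identifies `T₁` on `V` with `T₀` on `U`, so the two
contractions correspond. -/
theorem contractV_sepV (hp : D.SymmetricProduct T) :
    D.contractV T S.sepV = D.mulRightV S.c := by
  have h (u : D.U) : D.T₁ T (D.mulRightV u) = D.T₀ T u := hp.trA_mulRightU S.markov u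
  simp only [contractV, sepV, c, map_sum, map_smul, LinearMap.comp_apply, lTensor_tmul,
    LinearEquiv.coe_coe, TensorProduct.rid_tmul]
  exact Finset.sum_congr rfl fun j _ => congrArg (· • _) (h _)

theorem wV_mul_contractV (hp : D.SymmetricProduct T) : S.wV * D.contractV T S.sepV = 1 := by
  rw [contractV_sepV S hp, ← mulRightV_one, ← S.c_mul_w, mulRightV_mul]; rfl

theorem contractV_mul_wV (hp : D.SymmetricProduct T) : D.contractV T S.sepV * S.wV = 1 := by
  rw [contractV_sepV S hp, ← mulRightV_one, ← S.w_mul_c, mulRightV_mul]; rfl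

/-- The weak Hopf algebra structure of `B`. -/
abbrev weakHopfAlgebraB : WeakHopfAlgebra k D.B :=
  have := S.finite
  have := S.finite_B
  letI := S.weakHopfAlgebra
  dualWeakHopfAlgebra S.pair S.pair_bijective S.tensorPairing_comul fun _ => rfl

/-- The isomorphism of `A` with the dual of `B`. -/
def weakHopfEquiv :
    have := S.finite_B
    letI := S.weakHopfAlgebra
    letI := S.weakHopfAlgebraB
    WeakHopfEquiv k D.A (WeakHopfDual k D.B) :=
  have := S.finite
  have := S.finite_B
  letI := S.weakHopfAlgebra
  weakHopfEquivDual S.pair S.pair_bijective S.tensorPairing_comul fun _ => rfl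

/-- Both maps are adjoint to the antipode of `A` under a non-degenerate pairing. -/
theorem antipode_weakHopfAlgebraB (b : D.B) :
    letI := S.weakHopfAlgebraB
    WeakHopfAlgebra.antipode (k := k) b = S.antipodeB b := by
  have := S.finite
  have := S.finite_B
  let := S.weakHopfAlgebra
  rw [← sub_eq_zero]
  refine S.eq_zero_of_pair fun a => ?_
  rw [map_sub, sub_eq_zero, ← pair_antipode]
  exact (apply_antipode_dual S.pair S.pair_bijective S.tensorPairing_comul (fun _ => rfl) a b).symm

end CentralizerDuality

end StronglySeparableExtension

end DualWeakHopf

theorem mainTheorem4 {k N M : Type*} [Field k] [Ring N] [Ring M] [Algebra k N] [Algebra k M]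
    (D : StronglySeparableExtension k N M) (T : N →ₗ[k] k) (hT : D.IsMarkovTrace T)
    (hsymm : D.IsSymmetric) (hprod : D.SymmetricProduct T) (hirr : D.WeaklyIrreducible T)
    (hdepth : D.DepthTwo) :
    ∃ (f : D.V ⊗[k] D.V) (w : D.V),
      (IsSymmetricSeparabilityElement k f ∧
        ∀ f' : D.V ⊗[k] D.V, IsSymmetricSeparabilityElement k f' → f' = f) ∧
      (w * D.contractV T f = 1 ∧ D.contractV T f * w = 1) ∧
      (D.pairing T w).Nondegenerate ∧ (D.pairing' T w).Nondegenerate ∧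
      ∃ (_ : WeakHopfAlgebra k D.B) (_ : WeakHopfAlgebra k D.A) (_ : Module.Finite k D.B),
        (∀ (a a' : D.A) (b : D.B),
          D.pairing₂ T w (a ⊗ₜ[k] a') (Coalgebra.comul b) = D.pairing T w (a * a') b) ∧
        (∀ b : D.B, Coalgebra.counit (R := k) b = D.pairing T w 1 b) ∧
        (∀ (a : D.A) (b : D.B),
          D.pairing T w a b = D.pairing' T w a (WeakHopfAlgebra.antipode (k := k) b)) ∧
        (∀ (a : D.A) (b b' : D.B),
          D.pairing₂ T w (Coalgebra.comul a) (b ⊗ₜ[k] b') = D.pairing T w a (b * b')) ∧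
        (∀ a : D.A, Coalgebra.counit (R := k) a = D.pairing T w a 1) ∧
        (∀ (a : D.A) (b : D.B),
          D.pairing T w (WeakHopfAlgebra.antipode (k := k) a) b =
            D.pairing T w a (WeakHopfAlgebra.antipode (k := k) b)) ∧
        IsSemisimpleRing D.A ∧
        ∃ Φ : WeakHopfEquiv k D.A (WeakHopfDual k D.B),
          ∀ (a : D.A) (b : D.B), WeakHopfDual.toDual (Φ.toAlgEquiv a) b = D.pairing T w a b := by
  obtain ⟨S⟩ := hirr.nonempty_centralizerDuality hT hsymm hprod hdepth
  have := S.finite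
  have := S.finite_B
  let := S.weakHopfAlgebra
  have h := S.isSymmetricSeparabilityElement_sepV
  refine ⟨S.sepV, S.wV, ⟨h, fun f' hf' => h.unique hf'⟩,
    ⟨S.wV_mul_contractV hprod, S.contractV_mul_wV hprod⟩, S.pair_nondegenerate,
    S.pairing'_nondegenerate, S.weakHopfAlgebraB, S.weakHopfAlgebra, S.finite_B,
    tensorPairing_comul_dual S.pair S.pair_bijective S.tensorPairing_comul fun _ => rfl,
    fun b => rfl, fun a b => ?_, S.tensorPairing_comul, fun a => rfl,
    apply_antipode_dual S.pair S.pair_bijective S.tensorPairing_comul fun _ => rfl,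
    S.dualBases.isSemisimpleRing hirr.kanzaki, S.weakHopfEquiv, fun a b => rfl⟩
  -- The transported antipode is defined through `A*`; its relation to the second form is known for
  -- the explicit formula in terms of `kappa`.
  rw [S.antipode_weakHopfAlgebraB]
  exact S.pairing_eq_pairing'_antipodeB a b
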